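/- Let $d\ge 2$, $r\ge 0$, $\kappa,\alpha\in\mathbb R$. There is $\sigma_0>0$, depending only on $d,r,\kappa,\alpha$, such that for every penalty parameter $\sigma\ge\sigma_0$, every $\theta\in\{1,-1,0\}$ (the three interior penalty methods SIPG, NIPG, IIPG), all $b,M\in\mathbb R$ and every bounded open set $\Omega\subset\mathbb R^d$ (in particular every bounded Lipschitz domain) there is a constant $c\ge 0$, independent of the mesh and of the time partition, with the following property. Let $\mathcal T_h$ be a conforming mesh of $\Omega$: finitely many closed convex polytopes (for example triangles or convex quadrilaterals) with non-empty, pairwise disjoint interiors contained in $\Omega$, which cover $\Omega$, and any two of which meet in a common, possibly empty, face. Let it be shape regular with constant $\kappa$: every $K\in\mathcal T_h$ contains a ball of some radius $\rho>0$ with $\operatorname{diam}K\le\kappa\rho$. Let $E_h$ be the set of interior faces, that is, the $(d-1)$-dimensional intersections of two elements, and $h_e=\operatorname{diam}e$ for $e\in E_h$. Let $V_h$ be the space of functions that are a polynomial of total degree at most $r$ on each element. With unit normals $n^\pm$ outward for the two elements sharing a face, $[w]=w^-n^-+w^+n^+$ and $\{\nabla w\}=\tfrac12(\nabla w^-+\nabla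 w^+)$, put $$a_h(u,v)=\sum_{K}\int_K\nabla u\cdot\nabla v-\sum_{e\in E_h}\int_e\{\nabla u\}\cdot[v]\,ds+\theta\sum_{e\in E_h}\int_e\{\nabla v\}\cdot[u]\,ds+\sum_{e\in E_h}\int_e\frac{\sigma}{h_e}[u]\cdot[v]\,ds .$$ Let $0=t^0<t^1<\dots<t^N=T$ be a time partition with $t^{n}-t^{n-1}\le\Delta t$ for $1\le n\le N$, and let $u_{h1},u_{h2}\in C^1([0,T];V_h)$ satisfy, for $1\le n\le N$ and all $v_{h1},v_{h2}\in C([t^{n-1},t^n];V_h)$, $$\int_{t^{n-1}}^{t^n}\!\!\int_\Omega\partial_tu_{h1}v_{h1}=\int_{t^{n-1}}^{t^n}\!\!\big(-a_h(u_{h1},v_{h1})+\alpha a_h(u_{h2},v_{h1})\big)dt+\int_{t^{n-1}}^{t^n}\!\!\int_\Omega u_{h1}v_{h1}-\int_{t^{n-1}}^{t^n}\!\!\int_\Omega(u_{h1}^2+u_{h2}^2)u_{h1}v_{h1}+b\int_{t^{n-1}}^{t^n}\!\!\int_\Omega(u_{h1}^2+u_{h2}^2)u_{h2}v_{h1},$$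 $$\int_{t^{n-1}}^{t^n}\!\!\int_\Omega\partial_tu_{h2}v_{h2}=\int_{t^{n-1}}^{t^n}\!\!\big(-\alpha a_h(u_{h1},v_{h2})-a_h(u_{h2},v_{h2})\big)dt+\int_{t^{n-1}}^{t^n}\!\!\int_\Omega u_{h2}v_{h2}-\int_{t^{n-1}}^{t^n}\!\!\int_\Omega(u_{h1}^2+u_{h2}^2)u_{h2}v_{h2}-b\int_{t^{n-1}}^{t^n}\!\!\int_\Omega(u_{h1}^2+u_{h2}^2)u_{h1}v_{h2}.$$ Assume that $u_{h1}\le M$ and $u_{h2}\le M$ on every element at all times in $[0,T]$. Put $a^n=\tfrac12\big(\|u_{h1}(t^n)\|_{L^2(\Omega)}^2+\|u_{h2}(t^n)\|_{L^2(\Omega)}^2\big)$. Then for every constant $C\ge 1$ $$a^n\le C\,a^{n-1}+c\,(t^n-t^{n-1})\qquad(1\le n\le N),$$ and consequently $$a^N\le a^0C^N+c\,\Delta t\,\frac{C^N-1}{C-1}\quad\text{if }C\ne1,\qquad a^N\le a^0+c\,N\,\Delta t\quad\text{if }C=1 .$$ -/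

import Mathlib

noncomputable section

namespace GLDG

open MeasureTheory Set

/-- Points and vectors of Euclidean space `ℝ^d`. -/
abbrev Pt (d : ℕ) := EuclideanSpace ℝ (Fin d)

/-- Value of a polynomial in `d` variables at a point of `ℝ^d`. -/
def polyVal {d : ℕ} (p : MvPolynomial (Fin d) ℝ) (x : Pt d) : ℝ :=
  MvPolynomial.eval (fun k => x k) p

/-- Gradient of a polynomial at a point of `ℝ^d`. -/
def polyGrad {d : ℕ} (p : MvPolynomial (Fin d) ℝ) (x : Pt d) : Pt d :=
  WithLp.toLp 2 (fun k => polyVal (MvPolynomial.pderiv k p) x)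

/-- A conforming mesh of `Ω ⊆ ℝ^d`: finitely many closed convex polytopes with non-empty,
pairwise disjoint interiors, which tile `Ω`, any two of them meeting in a common
(possibly empty) face of both. -/
structure Mesh {d : ℕ} (Ω : Set (Pt d)) where
  /-- number of elements -/
  num : ℕ
  /-- the (closed) elements -/
  elem : Fin num → Set (Pt d)
  polytope : ∀ i, ∃ s : Finset (Pt d), elem i = convexHull ℝ (s : Set (Pt d))
  interior_nonempty : ∀ i, (interior (elem i)).Nonempty
  disjoint_interior : ∀ i j, i ≠ j → Disjoint (interior (elem i)) (interior (elem j))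
  interior_subset : ∀ i, interior (elem i) ⊆ Ω
  subset_iUnion : Ω ⊆ ⋃ i, elem i
  conforming : ∀ i j, i ≠ j → IsExposed ℝ (elem i) (elem i ∩ elem j)

/-- `n` is a unit normal to the interface `K ∩ L` pointing from `K` to `L`
(so `n` is outward for `K` and `-n` is outward for `L`). -/
def IsInterfaceNormal {d : ℕ} (K L : Set (Pt d)) (n : Pt d) : Prop :=
  ‖n‖ = 1 ∧ (∀ x ∈ K, ∀ y ∈ K ∩ L, inner ℝ n (x - y) ≤ 0) ∧
    ∀ x ∈ L, ∀ y ∈ K ∩ L, 0 ≤ inner ℝ n (x - y)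

namespace Mesh

variable {d : ℕ} {Ω : Set (Pt d)} (𝓣 : Mesh Ω)

/-- Shape regularity with constant `κ`: each element `K` contains a ball of some radius
`ρ > 0` with `diam K ≤ κ ρ`. -/
def ShapeRegular (κ : ℝ) : Prop :=
  ∀ i, ∃ (x : Pt d) (ρ : ℝ), 0 < ρ ∧ Metric.ball x ρ ⊆ 𝓣.elem i ∧
    Metric.diam (𝓣.elem i) ≤ κ * ρ

/-- The common part `K_i ∩ K_j` of the two elements of a pair. -/
def face (e : Fin 𝓣.num × Fin 𝓣.num) : Set (Pt d) := 𝓣.elem e.1 ∩ 𝓣.elem e.2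

open Classical in
/-- The set of interior edges (faces): each is the `(d-1)`-dimensional common part
of two elements, listed once, as the pair `(i, j)` with `i < j`. -/
def intFaces : Finset (Fin 𝓣.num × Fin 𝓣.num) :=
  Finset.univ.filter fun e =>
    e.1 < e.2 ∧ Module.finrank ℝ (vectorSpan ℝ (𝓣.face e)) + 1 = d

theorem exists_normal {i j : Fin 𝓣.num} (hij : i ≠ j) :
    ∃ n, IsInterfaceNormal (𝓣.elem i) (𝓣.elem j) n := by
  have hconv : ∀ i, Convex ℝ (𝓣.elem i) := fun i => by
    obtain ⟨s, hs⟩ := 𝓣.polytope i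
    rw [hs]; exact convex_convexHull ℝ _
  obtain ⟨f, s, hf1, hf2⟩ := geometric_hahn_banach_open_open (hconv i).interior isOpen_interior
    (hconv j).interior isOpen_interior (𝓣.disjoint_interior i j hij)
  have h1 : ∀ x ∈ 𝓣.elem i, f x ≤ s := fun x hx => by
    have hx' : x ∈ closure (interior (𝓣.elem i)) := by
      rw [(hconv i).closure_interior_eq_closure_of_nonempty_interior (𝓣.interior_nonempty i)]
      exact subset_closure hx
    exact closure_minimal (fun y hy => (hf1 y hy).le)
      (isClosed_le f.continuous continuous_const) hx'
  have h2 : ∀ x ∈ 𝓣.elem j, s ≤ f x := fun x hx => by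
    have hx' : x ∈ closure (interior (𝓣.elem j)) := by
      rw [(hconv j).closure_interior_eq_closure_of_nonempty_interior (𝓣.interior_nonempty j)]
      exact subset_closure hx
    exact closure_minimal (fun y hy => (hf2 y hy).le)
      (isClosed_le continuous_const f.continuous) hx'
  have hf : f ≠ 0 := by
    rintro rfl
    obtain ⟨x, hx⟩ := 𝓣.interior_nonempty i
    obtain ⟨y, hy⟩ := 𝓣.interior_nonempty j
    have ha := hf1 x hx
    have hb := hf2 y hy
    simp at ha hb
    linarith
  have hpos : 0 < ‖f‖ := norm_pos_iff.mpr hf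
  have hin : ∀ z, inner ℝ (‖f‖⁻¹ • (InnerProductSpace.toDual ℝ (Pt d)).symm f) z
      = ‖f‖⁻¹ * f z := fun z => by
    rw [real_inner_smul_left, InnerProductSpace.toDual_symm_apply]
  refine ⟨‖f‖⁻¹ • (InnerProductSpace.toDual ℝ (Pt d)).symm f, ?_, ?_, ?_⟩
  · rw [norm_smul, LinearIsometryEquiv.norm_map, norm_inv, norm_norm]
    exact inv_mul_cancel₀ hpos.ne'
  · intro x hx y hy
    rw [hin, map_sub]
    exact mul_nonpos_of_nonneg_of_nonpos (inv_pos.mpr hpos).le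
      (by linarith [h1 x hx, h2 y hy.2])
  · intro x hx y hy
    rw [hin, map_sub]
    exact mul_nonneg (inv_pos.mpr hpos).le (by linarith [h2 x hx, h1 y hy.1])

open Classical in
/-- The unit normal of the interior face given by the pair `(i, j)`, outward for `K_i`
(on a `(d-1)`-dimensional face it exists and is unique). -/
def normal (e : Fin 𝓣.num × Fin 𝓣.num) : Pt d :=
  if h : e.1 ≠ e.2 then (𝓣.exists_normal h).choose else 0

theorem normal_spec {e : Fin 𝓣.num × Fin 𝓣.num} (h : e.1 ≠ e.2) :
    IsInterfaceNormal (𝓣.elem e.1) (𝓣.elem e.2) (𝓣.normal e) := by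
  rw [normal, dif_pos h]
  exact (𝓣.exists_normal h).choose_spec

/-- The broken polynomial space `V_h`: one polynomial of total degree at most `r` on every
element, with no continuity across the faces. -/
abbrev Vh (r : ℕ) := Fin 𝓣.num → MvPolynomial.restrictTotalDegree (Fin d) ℝ r

variable {r : ℕ}

/-- Value on the element `K_i` of a function of `V_h` (also its trace from `K_i`). -/
def val (u : 𝓣.Vh r) (i : Fin 𝓣.num) (x : Pt d) : ℝ := polyVal (u i).1 x

/-- Gradient on the element `K_i` of a function of `V_h` (also its trace from `K_i`). -/
def grad (u : 𝓣.Vh r) (i : Fin 𝓣.num) (x : Pt d) : Pt d := polyGrad (u i).1 x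

/-- The integral over `Ω` of an elementwise defined function: the elements tile `Ω` up to
null sets. -/
def integ (f : Fin 𝓣.num → Pt d → ℝ) : ℝ := ∑ i, ∫ x in 𝓣.elem i, f i x

/-- The squared norm of `L²(Ω)`. -/
def normSq (u : 𝓣.Vh r) : ℝ := 𝓣.integ fun i x => 𝓣.val u i x ^ 2

/-- The jump `[w] = w⁻ n⁻ + w⁺ n⁺` on a face. -/
def jump (w : 𝓣.Vh r) (e : Fin 𝓣.num × Fin 𝓣.num) (x : Pt d) : Pt d :=
  𝓣.val w e.1 x • 𝓣.normal e + 𝓣.val w e.2 x • (-𝓣.normal e)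

/-- The average `{∇w} = (∇w⁺ + ∇w⁻) / 2` on a face. -/
def avgGrad (w : 𝓣.Vh r) (e : Fin 𝓣.num × Fin 𝓣.num) (x : Pt d) : Pt d :=
  (1 / 2 : ℝ) • (𝓣.grad w e.1 x + 𝓣.grad w e.2 x)

/-- The surface integral of `f` over a face, for the `(d-1)`-dimensional Euclidean
Hausdorff measure. -/
def faceInt (e : Fin 𝓣.num × Fin 𝓣.num) (f : Pt d → ℝ) : ℝ :=
  ∫ x in 𝓣.face e, f x ∂(Measure.euclideanHausdorffMeasure (d - 1))

/-- The interior penalty form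
`a_h(u,v) = ∑_K ∫_K ∇u·∇v - ∑_e ∫_e {∇u}·[v] + θ ∑_e ∫_e {∇v}·[u] + ∑_e (σ/h_e) ∫_e [u]·[v]`,
with `h_e` the diameter of `e`. -/
def ah (θ σ : ℝ) (u v : 𝓣.Vh r) : ℝ :=
  𝓣.integ (fun i x => inner ℝ (𝓣.grad u i x) (𝓣.grad v i x))
    - ∑ e ∈ 𝓣.intFaces, 𝓣.faceInt e (fun x => inner ℝ (𝓣.avgGrad u e x) (𝓣.jump v e x))
    + θ * ∑ e ∈ 𝓣.intFaces, 𝓣.faceInt e (fun x => inner ℝ (𝓣.avgGrad v e x) (𝓣.jump u e x))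
    + ∑ e ∈ 𝓣.intFaces,
        𝓣.faceInt e (fun x => σ / Metric.diam (𝓣.face e) *
          inner ℝ (𝓣.jump u e x) (𝓣.jump v e x))

/-- A time-dependent function with values in `V_h` is continuous on `I`
(all its coefficients are; `V_h` is finite-dimensional). -/
def TimeContinuousOn (v : ℝ → 𝓣.Vh r) (I : Set ℝ) : Prop :=
  ∀ i k, ContinuousOn (fun τ => (v τ i).1.coeff k) I

/-- `u` is continuously differentiable on `I` with values in `V_h` and with
derivative `u'`. -/
def HasTimeDerivOn (u u' : ℝ → 𝓣.Vh r) (I : Set ℝ) : Prop :=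
  (∀ i k, ∀ τ ∈ I,
    HasDerivWithinAt (fun ξ => (u ξ i).1.coeff k) ((u' τ i).1.coeff k) I τ) ∧
  𝓣.TimeContinuousOn u' I

/-- The pair `(u₁, u₂)` solves the semi-discrete interior penalty scheme for
`u_t = u + (1 + iα) Δu - (1 + ib) |u|² u`, `u = u₁ + i u₂`, on the time slabs
`[t_n, t_{n+1}]`, `n < N`, of `[0, T]`; test functions are continuous in time with
values in `V_h`. -/
def IsSolution (θ σ α b T : ℝ) (N : ℕ) (t : ℕ → ℝ) (u₁ u₂ : ℝ → 𝓣.Vh r) : Prop :=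
  ∃ u₁' u₂' : ℝ → 𝓣.Vh r,
    𝓣.HasTimeDerivOn u₁ u₁' (Icc 0 T) ∧ 𝓣.HasTimeDerivOn u₂ u₂' (Icc 0 T) ∧
    ∀ n < N, ∀ v₁ v₂ : ℝ → 𝓣.Vh r,
      𝓣.TimeContinuousOn v₁ (Icc (t n) (t (n + 1))) →
      𝓣.TimeContinuousOn v₂ (Icc (t n) (t (n + 1))) →
      (∫ τ in t n..t (n + 1), 𝓣.integ (fun i x => 𝓣.val (u₁' τ) i x * 𝓣.val (v₁ τ) i x))
        = (∫ τ in t n..t (n + 1),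
              (-𝓣.ah θ σ (u₁ τ) (v₁ τ) + α * 𝓣.ah θ σ (u₂ τ) (v₁ τ)))
          + (∫ τ in t n..t (n + 1),
              𝓣.integ (fun i x => 𝓣.val (u₁ τ) i x * 𝓣.val (v₁ τ) i x))
          - (∫ τ in t n..t (n + 1), 𝓣.integ (fun i x =>
              (𝓣.val (u₁ τ) i x ^ 2 + 𝓣.val (u₂ τ) i x ^ 2) *
                𝓣.val (u₁ τ) i x * 𝓣.val (v₁ τ) i x))
          + b * (∫ τ in t n..t (n + 1), 𝓣.integ (fun i x =>
              (𝓣.val (u₁ τ) i x ^ 2 + 𝓣.val (u₂ τ) i x ^ 2) *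
                𝓣.val (u₂ τ) i x * 𝓣.val (v₁ τ) i x)) ∧
      (∫ τ in t n..t (n + 1), 𝓣.integ (fun i x => 𝓣.val (u₂' τ) i x * 𝓣.val (v₂ τ) i x))
        = (∫ τ in t n..t (n + 1),
              (-(α * 𝓣.ah θ σ (u₁ τ) (v₂ τ)) - 𝓣.ah θ σ (u₂ τ) (v₂ τ)))
          + (∫ τ in t n..t (n + 1),
              𝓣.integ (fun i x => 𝓣.val (u₂ τ) i x * 𝓣.val (v₂ τ) i x))
          - (∫ τ in t n..t (n + 1), 𝓣.integ (fun i x =>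
              (𝓣.val (u₁ τ) i x ^ 2 + 𝓣.val (u₂ τ) i x ^ 2) *
                𝓣.val (u₂ τ) i x * 𝓣.val (v₂ τ) i x))
          - b * (∫ τ in t n..t (n + 1), 𝓣.integ (fun i x =>
              (𝓣.val (u₁ τ) i x ^ 2 + 𝓣.val (u₂ τ) i x ^ 2) *
                𝓣.val (u₁ τ) i x * 𝓣.val (v₂ τ) i x))

/-- `u ≤ M` on the whole domain at all times of `I`. -/
def BoundedBy (u : ℝ → 𝓣.Vh r) (M : ℝ) (I : Set ℝ) : Prop :=
  ∀ τ ∈ I, ∀ i, ∀ x ∈ 𝓣.elem i, 𝓣.val (u τ) i x ≤ M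

/-- The discrete energy `(‖u₁‖² + ‖u₂‖²) / 2` in `L²(Ω)`. -/
def energy (w₁ w₂ : 𝓣.Vh r) : ℝ := (𝓣.normSq w₁ + 𝓣.normSq w₂) / 2

end Mesh

end GLDG

end

/-! ### A weighted inverse inequality for polynomials on an interval. -/

section OneDimensional

open MeasureTheory Set Module Polynomial

/-! Test the scheme with the solution itself and add the two equations. The time derivative yields
the energy increment, the two `b` terms cancel, and the reaction terms integrate `s - s²` with `s =
u₁² + u₂²`, hence contribute at most `|Ω| / 4` per unit of time. Once the diffusion terms are known
to dissipate, the step estimate holds with `C = 1` and `c = |Ω| / 4`; a larger `C` only weakens it,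
and a geometric sum gives the final bounds.

The dissipation is `Mesh.exists_forall_ah_nonneg`. The antisymmetric part of `a_h`, which `α`
multiplies, consists of face terms `{∇u}·[v]` only, since the volume and penalty terms are
symmetric. Young's inequality (`Mesh.abs_fluxForm_le`) splits each face term into `h_e |{∇u}|²` and
`h_e⁻¹ |[v]|²`. A large penalty absorbs the second; the volume gradient absorbs the first through a
discrete trace inequality (`Mesh.sum_lintegral_face_le`).

That trace inequality must hold with a constant independent of the number and shape of the faces of
an element. Take the centre `x₀` of a ball of radius `ρ` inside the element. The cones with apex
`x₀` over its interfaces lie in the element and overlap in null sets, so their contributions add up.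
In polar coordinates on one cone, of height `δ ≥ ρ`, the inequality reduces to `q(1)² ≤ K ∫₀¹
s^(d-1) q(s)² ds` for polynomials of degree at most `r`, and `h_e ≤ κ δ` by shape regularity. -/

theorem Polynomial.sq_eval_le_sum_sq_eval_sub {n : ℕ} {q : ℝ[X]} (hq : q.natDegree < n) (x η : ℝ) :
    (q.eval x) ^ 2 ≤ (∑ k ∈ Finset.range n, (n.choose (k + 1) : ℝ) ^ 2) *
      ∑ k ∈ Finset.range n, (q.eval (x - (k + 1 : ℕ) * η)) ^ 2 := by
  have hdeg : (q.comp (C x - C η * X)).natDegree < n := by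
    refine lt_of_le_of_lt ?_ hq
    refine natDegree_comp_le.trans ?_
    have : (C x - C η * X : ℝ[X]).natDegree ≤ 1 := by compute_degree
    nlinarith
  -- The `n`-th finite difference of a polynomial of degree below `n` vanishes. For `s ↦ q (x - s
  -- η)` this writes `q x` as a binomial combination of the values at `x - η, …, x - n η`;
  -- Cauchy–Schwarz then concludes.
  have h0 := congrFun (Polynomial.fwdDiff_iter_eq_zero_of_degree_lt hdeg) 0
  rw [fwdDiff_iter_eq_sum_shift, Finset.sum_range_succ'] at h0
  simp only [Pi.zero_apply, eval_comp, eval_sub, eval_mul, eval_C, eval_X, zero_add,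
    nsmul_eq_mul, mul_one, Nat.sub_zero, Nat.choose_zero_right, Nat.cast_zero, mul_zero, sub_zero,
    zsmul_eq_mul] at h0
  have h1 : (q.eval x) ^ 2 = (∑ k ∈ Finset.range n,
      (((-1 : ℤ) ^ (n - (k + 1)) * (n.choose (k + 1) : ℤ) : ℤ) : ℝ) *
        q.eval (x - η * (k + 1 : ℕ))) ^ 2 := by
    rw [eq_neg_of_add_eq_zero_left h0]
    push_cast
    rw [mul_one, neg_sq, mul_pow, ← pow_mul, mul_comm n 2, pow_mul]
    norm_num
  rw [h1]
  refine (Finset.sum_mul_sq_le_sq_mul_sq _ _ _).trans (le_of_eq ?_)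
  congr 1
  · refine Finset.sum_congr rfl fun k _ => ?_
    push_cast
    rw [mul_pow, ← pow_mul, mul_comm _ 2, pow_mul]
    norm_num
  · simp only [mul_comm η]

/-- A weighted one-dimensional inverse (trace) inequality for polynomials of bounded degree. -/
theorem Polynomial.exists_sq_eval_one_le_integral (m r : ℕ) :
    ∃ K : ℝ, 0 ≤ K ∧ ∀ q : ℝ[X], q.natDegree ≤ r →
      (q.eval 1) ^ 2 ≤ K * ∫ s in (0 : ℝ)..1, s ^ m * (q.eval s) ^ 2 := by
  set n := r + 1 with hn
  have hn0 : (0 : ℝ) < n := by positivity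
  set A := ∑ k ∈ Finset.range n, (n.choose (k + 1) : ℝ) ^ 2
  have hA : 0 ≤ A := by positivity
  refine ⟨2 * n * (A * (n * 2 ^ m)), by positivity, fun q hq => ?_⟩
  have hcont : Continuous fun s : ℝ => (q.eval s) ^ 2 := by fun_prop
  have hcont' : Continuous fun s : ℝ => s ^ m * (q.eval s) ^ 2 := by fun_prop
  set J := ∫ s in (0 : ℝ)..1, s ^ m * (q.eval s) ^ 2
  -- On `[1/2, 1]` the weight satisfies `2 ^ m * s ^ m ≥ 1`, so it can be inserted at the cost of `2
  -- ^ m`.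
  have hhalf : ∀ a : ℝ, 1 / 2 ≤ a → a ≤ 1 → (∫ s in a..1, (q.eval s) ^ 2) ≤ 2 ^ m * J := by
    intro a ha ha1
    calc (∫ s in a..1, (q.eval s) ^ 2) ≤ ∫ s in a..1, 2 ^ m * (s ^ m * (q.eval s) ^ 2) := by
          refine intervalIntegral.integral_mono_on ha1 (hcont.intervalIntegrable _ _)
            ((hcont'.const_mul _).intervalIntegrable _ _) fun s hs => ?_
          rw [← mul_assoc, ← mul_pow]
          have : 1 ≤ (2 * s) ^ m := one_le_pow₀ (by linarith [hs.1])
          nlinarith [sq_nonneg (q.eval s)]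
      _ = 2 ^ m * ∫ s in a..1, s ^ m * (q.eval s) ^ 2 := by
          rw [intervalIntegral.integral_const_mul]
      _ ≤ 2 ^ m * J := by
          gcongr
          refine intervalIntegral.integral_mono_interval (by linarith) ha1 le_rfl ?_
            (hcont'.intervalIntegrable _ _)
          filter_upwards [ae_restrict_mem measurableSet_Ioc] with s hs
          have := hs.1.le
          simp only [Pi.zero_apply]
          positivity
  -- For `η ≤ 1 / (2n)` all the nodes `1 - (k + 1) η` stay in `[1/2, 1]`; the Jacobian `1 / (k + 1)`
  -- is bounded by one.
  have hterm : ∀ k ∈ Finset.range n,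
      (∫ η in (0 : ℝ)..1 / (2 * n), (q.eval (1 - (k + 1 : ℕ) * η)) ^ 2) ≤ 2 ^ m * J := by
    intro k hk
    have hk0 : (0 : ℝ) < (k + 1 : ℕ) := by positivity
    have hkn : ((k + 1 : ℕ) : ℝ) ≤ n := by exact_mod_cast Finset.mem_range.mp hk
    rw [intervalIntegral.integral_comp_sub_mul (fun s => (q.eval s) ^ 2) hk0.ne', mul_zero,
      sub_zero, smul_eq_mul]
    have h2 : ((k + 1 : ℕ) : ℝ) * (1 / (2 * n)) ≤ 1 / 2 := by
      rw [mul_one_div, div_le_iff₀ (by positivity)]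
      linarith
    have h3 : 0 ≤ ((k + 1 : ℕ) : ℝ) * (1 / (2 * n)) := by positivity
    have h4 := hhalf (1 - ((k + 1 : ℕ) : ℝ) * (1 / (2 * n))) (by linarith) (by linarith)
    refine le_trans ?_ h4
    refine mul_le_of_le_one_left
      (intervalIntegral.integral_nonneg (by linarith) fun s _ => sq_nonneg _)
      (inv_le_one_of_one_le₀ (by exact_mod_cast Nat.succ_le_succ (Nat.zero_le k)))
  -- Averaging the pointwise bound over `η` turns point values into integrals.
  have key : 1 / (2 * n) * (q.eval 1) ^ 2 ≤ A * (n * 2 ^ m * J) := by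
    calc 1 / (2 * n) * (q.eval 1) ^ 2
        = ∫ _ in (0 : ℝ)..1 / (2 * n), (q.eval 1) ^ 2 := by
          rw [intervalIntegral.integral_const, sub_zero, smul_eq_mul]
      _ ≤ ∫ η in (0 : ℝ)..1 / (2 * n),
            A * ∑ k ∈ Finset.range n, (q.eval (1 - (k + 1 : ℕ) * η)) ^ 2 := by
          refine intervalIntegral.integral_mono_on (by positivity) (by simp)
            (Continuous.intervalIntegrable (by fun_prop) _ _) fun η _ => ?_
          exact sq_eval_le_sum_sq_eval_sub (Nat.lt_succ_of_le hq) 1 η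
      _ = A * ∑ k ∈ Finset.range n,
            ∫ η in (0 : ℝ)..1 / (2 * n), (q.eval (1 - (k + 1 : ℕ) * η)) ^ 2 := by
          rw [intervalIntegral.integral_const_mul, intervalIntegral.integral_finsetSum]
          exact fun k _ => Continuous.intervalIntegrable (by fun_prop) _ _
      _ ≤ A * ∑ _k ∈ Finset.range n, 2 ^ m * J := by
          gcongr with k hk
          exact hterm k hk
      _ = A * (n * 2 ^ m * J) := by
          rw [Finset.sum_const, Finset.card_range, nsmul_eq_mul]
          ring
  rw [one_div, inv_mul_le_iff₀ (by positivity)] at key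
  linarith

end OneDimensional

open MeasureTheory Set Module

/-! ### Hausdorff measure on hyperplanes and integration over cones. -/

section Cone

variable {E : Type*} [NormedAddCommGroup E] [InnerProductSpace ℝ E] [FiniteDimensional ℝ E]
  [MeasurableSpace E] [BorelSpace E] {x₀ n : E} {δ : ℝ} {A : Set E}

omit [MeasurableSpace E] [BorelSpace E] in
theorem finrank_orthogonal_span_unit (hn : ‖n‖ = 1) :
    finrank ℝ (ℝ ∙ n)ᗮ = finrank ℝ E - 1 := by
  have hn0 : n ≠ 0 := by rintro rfl; simp at hn
  have h1 := (ℝ ∙ n).finrank_add_finrank_orthogonal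
  rw [finrank_span_singleton hn0] at h1
  omega

omit [FiniteDimensional ℝ E] [MeasurableSpace E] [BorelSpace E] in
theorem isometry_add_subtype (S : Submodule ℝ E) (y : E) :
    Isometry fun v : S => y + (v : E) :=
  (IsometryEquiv.addLeft y).isometry.comp isometry_subtype_coe

/-- On subsets of a hyperplane, the Euclidean Hausdorff measure of codimension one is the Lebesgue
measure of the direction of the hyperplane. -/
theorem euclideanHausdorffMeasure_eq_volume_preimage (hn : ‖n‖ = 1) (y : E)
    (hA : ∀ x ∈ A, inner ℝ n (x - y) = 0) :
    (μHE[finrank ℝ E - 1] : Measure E) A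
      = volume ((fun v : (ℝ ∙ n)ᗮ => y + (v : E)) ⁻¹' A) := by
  rw [← InnerProductSpace.euclideanHausdorffMeasure_eq_volume, finrank_orthogonal_span_unit hn,
    (isometry_add_subtype _ y).euclideanHausdorffMeasure_preimage, inter_eq_left.mpr]
  intro x hx
  exact ⟨⟨x - y, Submodule.mem_orthogonal_singleton_iff_inner_right.mpr (hA x hx)⟩, by simp⟩

theorem euclideanHausdorffMeasure_lt_top_of_isCompact (hn : ‖n‖ = 1) (hAc : IsCompact A)
    (hA : ∀ x ∈ A, ∀ y ∈ A, inner ℝ n (x - y) = 0) :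
    (μHE[finrank ℝ E - 1] : Measure E) A < ⊤ := by
  rcases A.eq_empty_or_nonempty with rfl | ⟨y, hy⟩
  · simp
  rw [euclideanHausdorffMeasure_eq_volume_preimage hn y fun x hx => hA x hx y hy]
  exact ((isometry_add_subtype _ y).isClosedEmbedding.isCompact_preimage hAc).measure_lt_top

/-- A closed convex subset of a hyperplane which is not a null set has a relative interior point. -/
theorem exists_forall_mem_of_euclideanHausdorffMeasure_ne_zero (hn : ‖n‖ = 1) (hAc : IsClosed A)
    (hconv : Convex ℝ A) (hA : ∀ x ∈ A, ∀ y ∈ A, inner ℝ n (x - y) = 0)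
    (h0 : (μHE[finrank ℝ E - 1] : Measure E) A ≠ 0) :
    ∃ z ∈ A, ∃ ε > 0, ∀ y, inner ℝ n (y - z) = 0 → ‖y - z‖ < ε → y ∈ A := by
  rcases A.eq_empty_or_nonempty with rfl | ⟨y, hy⟩
  · simp at h0
  rw [euclideanHausdorffMeasure_eq_volume_preimage hn y fun x hx => hA x hx y hy] at h0
  set B := (fun v : (ℝ ∙ n)ᗮ => y + (v : E)) ⁻¹' A with hB
  have hBconv : Convex ℝ B := by
    have := (hconv.translate_preimage_right y).linear_preimage (ℝ ∙ n)ᗮ.subtype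
    exact this
  have hBc : IsClosed B := hAc.preimage (isometry_add_subtype _ y).continuous
  have hint : (interior B).Nonempty := by
    -- A closed set with empty interior is its own frontier, and the frontier of a convex set is
    -- Lebesgue null.
    by_contra! hempty
    refine h0 ?_
    have := hBconv.addHaar_frontier volume
    rwa [frontier, hBc.closure_eq, hempty, sdiff_empty] at this
  obtain ⟨w, hw⟩ := hint
  obtain ⟨ε, hε, hball⟩ := Metric.mem_nhds_iff.mp (mem_interior_iff_mem_nhds.mp hw)
  refine ⟨y + w, (interior_subset hw : w ∈ B), ε, hε, fun x hx hxε => ?_⟩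
  have hx' : x - (y + w) ∈ (ℝ ∙ n)ᗮ :=
    Submodule.mem_orthogonal_singleton_iff_inner_right.mpr hx
  have : w + ⟨x - (y + w), hx'⟩ ∈ B := by
    refine hball ?_
    rw [Metric.mem_ball, dist_eq_norm, add_sub_cancel_left]
    exact hxε
  have h2 : y + ((w : E) + (x - (y + w))) ∈ A := this
  convert h2 using 1
  abel

omit [FiniteDimensional ℝ E] [MeasurableSpace E] [BorelSpace E] in
theorem mem_convexJoin_singleton {x : E} :
    x ∈ convexJoin ℝ {x₀} A ↔ ∃ y ∈ A, ∃ s ∈ Icc (0 : ℝ) 1, AffineMap.lineMap x₀ y s = x := by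
  simp [segment_eq_image_lineMap]

omit [FiniteDimensional ℝ E] [MeasurableSpace E] [BorelSpace E] in
theorem isCompact_convexJoin_singleton (hA : IsCompact A) : IsCompact (convexJoin ℝ {x₀} A) := by
  have : convexJoin ℝ {x₀} A
      = (fun z : E × ℝ => AffineMap.lineMap x₀ z.1 z.2) '' (A ×ˢ Icc (0 : ℝ) 1) := by
    ext x
    rw [mem_convexJoin_singleton]
    constructor
    · rintro ⟨y, hy, s, hs, rfl⟩
      exact ⟨(y, s), ⟨hy, hs⟩, rfl⟩
    · rintro ⟨⟨y, s⟩, ⟨hy, hs⟩, rfl⟩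
      exact ⟨y, hy, s, hs, rfl⟩
  rw [this]
  refine (hA.prod isCompact_Icc).image ?_
  simp only [AffineMap.lineMap_apply, vsub_eq_sub, vadd_eq_add]
  fun_prop

omit [FiniteDimensional ℝ E] [MeasurableSpace E] [BorelSpace E] in
theorem inner_lineMap_sub (hA : ∀ y ∈ A, inner ℝ n (y - x₀) = δ) {y : E} (hy : y ∈ A) (s : ℝ) :
    inner ℝ n (AffineMap.lineMap x₀ y s - x₀) = s * δ := by
  rw [AffineMap.lineMap_apply, vsub_eq_sub, vadd_eq_add, add_sub_cancel_right,
    real_inner_smul_right, hA y hy]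

omit [FiniteDimensional ℝ E] [MeasurableSpace E] [BorelSpace E] in
theorem mem_mk'_orthogonal_span_unit_iff (hn : ‖n‖ = 1) {x : E} {c : ℝ} :
    x ∈ (AffineSubspace.mk' (c • n +ᵥ x₀) (ℝ ∙ n)ᗮ : Set E) ↔ inner ℝ n (x - x₀) = c := by
  rw [SetLike.mem_coe, AffineSubspace.mem_mk', Submodule.mem_orthogonal_singleton_iff_inner_right,
    vsub_eq_sub, vadd_eq_add, sub_add_eq_sub_sub_swap, inner_sub_right, real_inner_smul_right,
    real_inner_self_eq_norm_sq, hn, one_pow, mul_one, sub_eq_zero]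

/-- Cavalieri's principle for slices orthogonal to `n`; as `n` is a unit vector, no factor `‖n‖`
appears. -/
theorem volume_eq_lintegral_slice (hn : ‖n‖ = 1) (x₀ : E) {t : Set E} (ht : MeasurableSet t) :
    volume t = ∫⁻ c : ℝ, (μHE[finrank ℝ E - 1] : Measure E)
      (t ∩ {x | inner ℝ n (x - x₀) = c}) := by
  have hn0 : n ≠ 0 := by rintro rfl; simp at hn
  rw [← InnerProductSpace.euclideanHausdorffMeasure_eq_volume,
    EuclideanGeometry.euclideanHausdorffMeasure_eq_lintegral x₀ hn0 ht,
    show ‖n‖ₑ = 1 by rw [← ofReal_norm, hn, ENNReal.ofReal_one], one_mul]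
  refine lintegral_congr fun c => ?_
  congr 2
  ext x
  exact mem_mk'_orthogonal_span_unit_iff hn

/-- The cone over a null set of a hyperplane is a null set. -/
theorem volume_convexJoin_eq_zero (hn : ‖n‖ = 1) (hδ : 0 < δ) (hAc : IsCompact A)
    (hA : ∀ y ∈ A, inner ℝ n (y - x₀) = δ) (h0 : (μHE[finrank ℝ E - 1] : Measure E) A = 0) :
    volume (convexJoin ℝ {x₀} A) = 0 := by
  rw [volume_eq_lintegral_slice hn x₀ (isCompact_convexJoin_singleton hAc).measurableSet]
  have hne : ∀ᵐ c : ℝ, c ≠ 0 := by simp [ae_iff]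
  refine (lintegral_congr_ae (g := fun _ => 0) ?_).trans lintegral_zero
  filter_upwards [hne] with c hc
  -- The slice at height `c` lies in the image of `A` under the dilation of ratio `c / δ`. The
  -- height `c = 0` is discarded because a dilation must have nonzero ratio.
  refine measure_mono_null (t := AffineMap.homothety x₀ (c / δ) '' A) ?_ ?_
  · rintro x ⟨hx, hxc⟩
    obtain ⟨y, hy, s, -, rfl⟩ := mem_convexJoin_singleton.mp hx
    rw [mem_ofPred_eq, inner_lineMap_sub hA hy] at hxc
    refine ⟨y, hy, ?_⟩
    rw [← hxc, mul_div_cancel_right₀ _ hδ.ne', AffineMap.homothety_eq_lineMap]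
  · rw [euclideanHausdorffMeasure_homothety_image _ _ (div_ne_zero hc hδ.ne'), h0, smul_zero]

/-- Integration in polar coordinates over the cone with apex `x₀` over a subset of a hyperplane at
distance `δ` of `x₀`. -/
theorem lintegral_convexJoin_ge (hn : ‖n‖ = 1) (hδ : 0 < δ) (hAc : IsCompact A)
    (hA : ∀ y ∈ A, inner ℝ n (y - x₀) = δ) {f : E → ENNReal} (hf : Measurable f) :
    ENNReal.ofReal δ * ∫⁻ y in A, (∫⁻ s in Ioc (0 : ℝ) 1,
        ENNReal.ofReal (s ^ (finrank ℝ E - 1)) * f (AffineMap.lineMap x₀ y s))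
        ∂(μHE[finrank ℝ E - 1] : Measure E)
      ≤ ∫⁻ x in convexJoin ℝ {x₀} A, f x := by
  set m := finrank ℝ E - 1
  have hfin : IsFiniteMeasure ((μHE[m] : Measure E).restrict A) :=
    isFiniteMeasure_restrict.mpr (euclideanHausdorffMeasure_lt_top_of_isCompact hn hAc
      fun x hx y hy => by
        rw [← sub_sub_sub_cancel_right x y x₀, inner_sub_right, hA x hx, hA y hy, sub_self]).ne
  -- The density `δ s ^ m` is the Jacobian of `(s, y) ↦ x₀ + s (y - x₀)`: `s ^ m` scales the slice,
  -- `δ` is the height of the cone.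
  set ν : Measure ℝ := (volume.restrict (Ioc (0 : ℝ) 1)).withDensity
    fun s => ENNReal.ofReal δ * ENNReal.ofReal (s ^ m) with hν
  have hdens : Measurable fun s : ℝ => ENNReal.ofReal δ * ENNReal.ofReal (s ^ m) := by fun_prop
  have hΨ : Measurable fun z : ℝ × E => AffineMap.lineMap x₀ z.2 z.1 := by
    simp only [AffineMap.lineMap_apply, vsub_eq_sub, vadd_eq_add]
    fun_prop
  set Ψ := fun z : ℝ × E => AffineMap.lineMap x₀ z.2 z.1 with hΨdef
  -- Only this inequality of measures is needed, which avoids any injectivity of `Ψ`. It is checked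
  -- slice by slice: the slice at height `δ s` contains the dilate of ratio `s` of the relevant part
  -- of `A`.
  have hle : (ν.prod ((μHE[m] : Measure E).restrict A)).map Ψ
      ≤ volume.restrict (convexJoin ℝ {x₀} A) := by
    refine Measure.le_iff.mpr fun t ht => ?_
    rw [Measure.map_apply hΨ ht, Measure.prod_apply (hΨ ht), Measure.restrict_apply ht,
      volume_eq_lintegral_slice hn x₀
        (ht.inter (isCompact_convexJoin_singleton hAc).measurableSet),
      lintegral_withDensity_eq_lintegral_mul₀ hdens.aemeasurable
        (measurable_measure_prodMk_left (hΨ ht)).aemeasurable]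
    have hsub : ∀ s ∈ Ioc (0 : ℝ) 1, ENNReal.ofReal (s ^ m) *
        ((μHE[m] : Measure E).restrict A) (Prod.mk s ⁻¹' (Ψ ⁻¹' t)) ≤
        (μHE[m] : Measure E) (t ∩ convexJoin ℝ {x₀} A ∩ {x | inner ℝ n (x - x₀) = δ * s}) := by
      intro s hs
      rw [Measure.restrict_apply (measurable_prodMk_left (hΨ ht))]
      have h1 : ENNReal.ofReal (s ^ m) = ((‖s‖₊ ^ m : NNReal) : ENNReal) := by
        rw [ENNReal.ofReal, ENNReal.coe_inj]
        ext
        simp [abs_of_pos hs.1, hs.1.le]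
      rw [h1, ← smul_eq_mul, ← ENNReal.smul_def,
        ← euclideanHausdorffMeasure_homothety_image m x₀ hs.1.ne']
      refine measure_mono ?_
      rintro _ ⟨y, ⟨hyt, hyA⟩, rfl⟩
      rw [AffineMap.homothety_eq_lineMap]
      refine ⟨⟨hyt, mem_convexJoin_singleton.mpr ⟨y, hyA, s, ⟨hs.1.le, hs.2⟩, rfl⟩⟩, ?_⟩
      rw [mem_ofPred_eq, inner_lineMap_sub hA hyA, mul_comm]
    have hemb : MeasurableEmbedding fun s : ℝ => δ * s :=
      (Homeomorph.mulLeft₀ δ hδ.ne').measurableEmbedding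
    conv_rhs => rw [← Real.smul_map_volume_mul_left hδ.ne', lintegral_smul_measure,
      hemb.lintegral_map, smul_eq_mul, abs_of_pos hδ]
    rw [← lintegral_const_mul' _ _ ENNReal.ofReal_ne_top]
    refine le_trans ?_ (setLIntegral_le_lintegral (Ioc (0 : ℝ) 1) _)
    refine setLIntegral_mono' measurableSet_Ioc fun s hs => ?_
    simp only [Pi.mul_apply, mul_assoc]
    gcongr
    exact hsub s hs
  calc _ = ∫⁻ x, f x ∂((ν.prod ((μHE[m] : Measure E).restrict A)).map Ψ) := by
        rw [lintegral_map hf hΨ, lintegral_prod_symm (fun z => f (Ψ z)) (hf.comp hΨ).aemeasurable,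
          ← lintegral_const_mul' _ _ ENNReal.ofReal_ne_top]
        refine lintegral_congr fun y => ?_
        have hm : Measurable fun s => f (Ψ (s, y)) := (hf.comp hΨ).comp measurable_prodMk_right
        rw [lintegral_withDensity_eq_lintegral_mul₀ hdens.aemeasurable hm.aemeasurable,
          ← lintegral_const_mul' _ _ ENNReal.ofReal_ne_top]
        refine lintegral_congr fun s => ?_
        simp only [Pi.mul_apply, hΨdef]
        ring
    _ ≤ _ := lintegral_mono' hle le_rfl

/-- A trace inequality from a subset of a hyperplane to the cone over it, for functions which are
polynomials along the rays of the cone and satisfy the one-dimensional trace inequality there. -/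
theorem lintegral_sq_le_lintegral_convexJoin {r : ℕ} {K : ℝ} (hK0 : 0 ≤ K)
    (hK : ∀ q : Polynomial ℝ, q.natDegree ≤ r →
      (q.eval 1) ^ 2 ≤ K * ∫ s in (0 : ℝ)..1, s ^ (finrank ℝ E - 1) * (q.eval s) ^ 2)
    (hn : ‖n‖ = 1) (hδ : 0 < δ) (hAc : IsCompact A)
    (hA : ∀ y ∈ A, inner ℝ n (y - x₀) = δ) {g : E → ℝ} (hg : Continuous g)
    (hgr : ∀ y, ∃ q : Polynomial ℝ, q.natDegree ≤ r ∧
      ∀ s, q.eval s = g (AffineMap.lineMap x₀ y s)) :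
    ENNReal.ofReal δ * ∫⁻ y in A, ENNReal.ofReal (g y ^ 2) ∂(μHE[finrank ℝ E - 1] : Measure E)
      ≤ ENNReal.ofReal K * ∫⁻ x in convexJoin ℝ {x₀} A, ENNReal.ofReal (g x ^ 2) := by
  have hf : Measurable fun x => ENNReal.ofReal (g x ^ 2) := by fun_prop
  refine le_trans ?_ (mul_le_mul_right (lintegral_convexJoin_ge hn hδ hAc hA hf) _)
  rw [mul_left_comm, ← lintegral_const_mul' (ENNReal.ofReal K) _ ENNReal.ofReal_ne_top]
  refine mul_le_mul_right (lintegral_mono fun y => ?_) _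
  obtain ⟨q, hq, hqs⟩ := hgr y
  have h1 := hK q hq
  have hcont : Continuous fun s : ℝ => s ^ (finrank ℝ E - 1) * (q.eval s) ^ 2 := by fun_prop
  rw [hqs, AffineMap.lineMap_apply_one, intervalIntegral.integral_of_le zero_le_one] at h1
  refine (ENNReal.ofReal_le_ofReal h1).trans (le_of_eq ?_)
  rw [ENNReal.ofReal_mul hK0, ofReal_integral_eq_lintegral_ofReal
    ((hcont.integrableOn_Icc).mono_set Ioc_subset_Icc_self)]
  · congr 1
    refine setLIntegral_congr_fun measurableSet_Ioc fun s hs => ?_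
    simp only [hqs]
    rw [ENNReal.ofReal_mul (pow_nonneg hs.1.le _)]
  · filter_upwards [ae_restrict_mem measurableSet_Ioc] with s hs
    have := hs.1.le
    simp only [Pi.zero_apply]
    positivity

end Cone

/-! ### Interfaces of convex bodies and the cones over them. -/

theorem Convex.eventually_add_smul_mem_interior {E : Type*} [NormedAddCommGroup E]
    [InnerProductSpace ℝ E] {L : Set E} (hL : Convex ℝ L) {n z p : E} (hn : ‖n‖ = 1)
    (hp : p ∈ interior L) (hpz : 0 < inner ℝ n (p - z)) {ε : ℝ} (hε : 0 < ε)
    (h : ∀ y, inner ℝ n (y - z) = 0 → ‖y - z‖ < ε → y ∈ L) :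
    ∀ᶠ t in nhdsWithin (0 : ℝ) (Ioi 0), z + t • n ∈ interior L := by
  set a := inner ℝ n (p - z)
  have hc : ContinuousAt (fun t : ℝ => (1 - t / a)⁻¹ • (t • n - (t / a) • (p - z))) 0 := by
    have : ContinuousAt (fun t : ℝ => (1 - t / a)⁻¹) 0 :=
      ContinuousAt.inv₀ (by fun_prop) (by simp)
    fun_prop
  have h1 : ∀ᶠ t in nhds (0 : ℝ), ‖(1 - t / a)⁻¹ • (t • n - (t / a) • (p - z))‖ < ε := by
    have := hc.norm.tendsto
    simp only [zero_div, zero_smul, sub_zero, smul_zero, norm_zero] at this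
    exact this.eventually_lt_const hε
  have h2 : ∀ᶠ t in nhds (0 : ℝ), t < a := Iio_mem_nhds hpz
  filter_upwards [self_mem_nhdsWithin, nhdsWithin_le_nhds h1, nhdsWithin_le_nhds h2]
    with t ht0 ht1 ht2
  have ht0' : 0 < t := ht0
  have hs0 : 0 < t / a := by positivity
  have hs1 : 0 < 1 - t / a := by rw [sub_pos, div_lt_one hpz]; exact ht2
  -- This is the point `y` solving `z + t n = (1 - t/a) y + (t/a) p`. The weight `t / a` keeps `y`
  -- in the hyperplane through `z`, and `y` tends to `z` as `t → 0`; so `z + t n` is a combination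
  -- of a point of `L` and an interior point.
  have hy : z + (1 - t / a)⁻¹ • (t • n - (t / a) • (p - z)) ∈ L := by
    refine h _ ?_ (by rwa [add_sub_cancel_left])
    rw [add_sub_cancel_left, real_inner_smul_right, inner_sub_right, real_inner_smul_right,
      real_inner_smul_right, real_inner_self_eq_norm_sq, hn, div_mul_cancel₀ _ hpz.ne']
    ring
  have := hL.combo_self_interior_mem_interior hy hp hs1.le hs0 (by ring)
  convert this using 1
  rw [smul_add, smul_smul, mul_inv_cancel₀ hs1.ne']
  module

namespace GLDG

variable {d : ℕ}

namespace IsInterfaceNormal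

variable {K L L' : Set (Pt d)} {n n' : Pt d}

theorem symm (h : IsInterfaceNormal K L n) : IsInterfaceNormal L K (-n) := by
  refine ⟨by rw [norm_neg, h.1], fun x hx y hy => ?_, fun x hx y hy => ?_⟩
  · rw [inner_neg_left, neg_nonpos]
    exact h.2.2 x hx y hy.symm
  · rw [inner_neg_left, neg_nonneg]
    exact h.2.1 x hx y hy.symm

theorem inner_sub_eq_zero (h : IsInterfaceNormal K L n) {x y : Pt d} (hx : x ∈ K ∩ L)
    (hy : y ∈ K ∩ L) : inner ℝ n (x - y) = 0 :=
  le_antisymm (h.2.1 x hx.1 y hy) (h.2.2 x hx.2 y hy)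

/-- The plane of the interface supports `K`, so a ball inside `K` cannot cross it. This bounds the
heights of the cones from below. -/
theorem le_inner_sub (h : IsInterfaceNormal K L n) {x₀ y : Pt d} {ρ : ℝ} (hρ : 0 < ρ)
    (hball : Metric.ball x₀ ρ ⊆ K) (hy : y ∈ K ∩ L) : ρ ≤ inner ℝ n (y - x₀) := by
  by_contra! hlt
  obtain ⟨t, ht, htρ⟩ := exists_between (max_lt hlt hρ)
  rw [max_lt_iff] at ht
  have hmem : x₀ + t • n ∈ K := hball (by
    rw [Metric.mem_ball, dist_eq_norm, add_sub_cancel_left, norm_smul, h.1, mul_one,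
      Real.norm_of_nonneg ht.2.le]
    exact htρ)
  have h1 := h.2.1 _ hmem y hy
  rw [← sub_sub_sub_cancel_right _ y x₀, add_sub_cancel_left, inner_sub_right,
    real_inner_smul_right, real_inner_self_eq_norm_sq, h.1] at h1
  linarith

/-- Three elements, two of which lie on the other side of an interface of the first one and have
disjoint interiors, meet in a null set of the interface. -/
theorem euclideanHausdorffMeasure_inter_eq_zero (h : IsInterfaceNormal K L n)
    (h' : IsInterfaceNormal K L' n') (hK : IsCompact K) (hL : IsCompact L) (hL' : IsCompact L')
    (hKc : Convex ℝ K) (hLc : Convex ℝ L) (hLc' : Convex ℝ L') (hKi : (interior K).Nonempty)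
    (hLi : (interior L).Nonempty) (hLi' : (interior L').Nonempty)
    (hdisj : Disjoint (interior L) (interior L')) :
    (Measure.euclideanHausdorffMeasure (d - 1) : Measure (Pt d)) ((K ∩ L) ∩ (K ∩ L')) = 0 := by
  -- Otherwise the triple intersection contains a relative disc about some `z`. Then the two planes
  -- coincide, `L` and `L'` lie on the same side of it, and `z + t n` is interior to both for small
  -- `t > 0`.
  by_contra h0
  have hd : finrank ℝ (Pt d) - 1 = d - 1 := by rw [finrank_euclideanSpace_fin]
  rw [← hd] at h0
  obtain ⟨z, hz, ε, hε, hzε⟩ := exists_forall_mem_of_euclideanHausdorffMeasure_ne_zero h.1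
    ((hK.inter hL).inter (hK.inter hL')).isClosed
    ((hKc.inter hLc).inter (hKc.inter hLc')) (fun x hx y hy => h.inner_sub_eq_zero hx.1 hy.1) h0
  have hpos : ∀ {K L : Set (Pt d)} {n : Pt d}, IsInterfaceNormal K L n →
      z ∈ K ∩ L → ∀ x ∈ interior K, 0 < inner ℝ n (z - x) := by
    intro K L n h hz x hx
    obtain ⟨ρ, hρ, hball⟩ := Metric.mem_nhds_iff.mp (mem_interior_iff_mem_nhds.mp hx)
    exact hρ.trans_le (h.le_inner_sub hρ hball hz)
  -- the two normals are positively proportional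
  set c := inner ℝ n n'
  set w := n' - c • n with hw
  have hnw : inner ℝ n w = 0 := by
    rw [hw, inner_sub_right, real_inner_smul_right, real_inner_self_eq_norm_sq, h.1]
    ring
  -- Moving `z` slightly along `w` stays in the disc, hence in the plane orthogonal to `n'`.
  have hn'w : inner ℝ n' w = 0 := by
    obtain ⟨t, ht, htε⟩ : ∃ t : ℝ, 0 < t ∧ t * ‖w‖ < ε := by
      refine ⟨ε / (‖w‖ + 1), by positivity, ?_⟩
      rw [div_mul_eq_mul_div, div_lt_iff₀ (by positivity)]
      nlinarith
    have hy := hzε (z + t • w) (by rw [add_sub_cancel_left, real_inner_smul_right, hnw, mul_zero])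
      (by rwa [add_sub_cancel_left, norm_smul, Real.norm_of_nonneg ht.le])
    have := h'.inner_sub_eq_zero hy.2 hz.2
    rw [add_sub_cancel_left, real_inner_smul_right] at this
    exact (mul_eq_zero.mp this).resolve_left ht.ne'
  have hw0 : w = 0 := by
    rw [← inner_self_eq_zero (𝕜 := ℝ)]
    nth_rewrite 1 [hw]
    rw [inner_sub_left, real_inner_smul_left, hnw, hn'w, mul_zero, sub_zero]
  have hn' : n' = c • n := sub_eq_zero.mp hw0
  obtain ⟨x, hx⟩ := hKi
  obtain ⟨p, hp⟩ := hLi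
  obtain ⟨p', hp'⟩ := hLi'
  have hx1 := hpos h hz.1 x hx
  have hx2 := hpos h' hz.2 x hx
  have hp1 := hpos h.symm hz.1.symm p hp
  have hp2 := hpos h'.symm hz.2.symm p' hp'
  rw [inner_neg_left, ← inner_neg_right, neg_sub] at hp1 hp2
  rw [hn', real_inner_smul_left] at hx2 hp2
  have hc : 0 < c := (pos_iff_pos_of_mul_pos hx2).mpr hx1
  have hp2' : 0 < inner ℝ n (p' - z) := (pos_iff_pos_of_mul_pos hp2).mp hc
  have e1 := hLc.eventually_add_smul_mem_interior h.1 hp hp1 hε fun y hy hyε => (hzε y hy hyε).1.2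
  have e2 := hLc'.eventually_add_smul_mem_interior h.1 hp' hp2' hε
    fun y hy hyε => (hzε y hy hyε).2.2
  obtain ⟨t, ht1, ht2⟩ := (e1.and e2).exists
  exact disjoint_left.mp hdisj ht1 ht2

/-- The cones over two interfaces of a convex set overlap in the cone over the intersection. -/
theorem convexJoin_inter_subset (h : IsInterfaceNormal K L n) (h' : IsInterfaceNormal K L' n')
    {x₀ : Pt d} (hx₀ : x₀ ∈ interior K) :
    convexJoin ℝ {x₀} (K ∩ L) ∩ convexJoin ℝ {x₀} (K ∩ L')
      ⊆ {x₀} ∪ convexJoin ℝ {x₀} ((K ∩ L) ∩ (K ∩ L')) := by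
  obtain ⟨ρ, hρ, hball⟩ := Metric.mem_nhds_iff.mp (mem_interior_iff_mem_nhds.mp hx₀)
  rintro x ⟨hx, hx'⟩
  obtain ⟨y, hy, s, hs, rfl⟩ := mem_convexJoin_singleton.mp hx
  obtain ⟨y', hy', s', hs', heq⟩ := mem_convexJoin_singleton.mp hx'
  by_cases hxx : AffineMap.lineMap x₀ y s = x₀
  · exact Or.inl hxx
  right
  simp only [AffineMap.lineMap_apply, vsub_eq_sub, vadd_eq_add, add_left_inj] at heq hxx
  -- A point `y` of `K` on the ray through `y'` cannot lie beyond the plane containing `y'`, which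
  -- forces `s' ≤ s`; exchanging the roles gives equality.
  have key : ∀ {L' : Set (Pt d)} {n' y y' : Pt d} {s s' : ℝ}, IsInterfaceNormal K L' n' →
      y ∈ K → y' ∈ K ∩ L' → 0 ≤ s → s' • (y' - x₀) = s • (y - x₀) → s' ≤ s := by
    intro L' n' y y' s s' h' hy hy' hs heq
    have h1 := h'.le_inner_sub hρ hball hy'
    have h2 := h'.2.1 y hy y' hy'
    have h3 : s' * inner ℝ n' (y' - x₀) = s * inner ℝ n' (y - x₀) := by
      rw [← real_inner_smul_right, heq, real_inner_smul_right]
    rw [← sub_sub_sub_cancel_right y y' x₀, inner_sub_right] at h2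
    nlinarith
  have hss : s' = s :=
    le_antisymm (key h' hy.1 hy' hs.1 heq) (key h hy'.1 hy hs'.1 heq.symm)
  subst hss
  have hs0 : s' ≠ 0 := by
    rintro rfl
    simp at hxx
  have hyy : y' = y := sub_left_inj.mp (smul_right_injective (Pt d) hs0 heq)
  subst hyy
  exact mem_convexJoin_singleton.mpr ⟨y', ⟨hy, hy'⟩, s', hs, rfl⟩

end IsInterfaceNormal

/-! ### The trace inequality on an element. -/

namespace Mesh

variable {Ω : Set (Pt d)} (𝓣 : Mesh Ω)

theorem convex_elem (i : Fin 𝓣.num) : Convex ℝ (𝓣.elem i) := by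
  obtain ⟨s, hs⟩ := 𝓣.polytope i
  rw [hs]
  exact convex_convexHull ℝ _

theorem isCompact_elem (i : Fin 𝓣.num) : IsCompact (𝓣.elem i) := by
  obtain ⟨s, hs⟩ := 𝓣.polytope i
  rw [hs]
  exact s.finite_toSet.isCompact_convexHull ℝ

theorem isCompact_face (e : Fin 𝓣.num × Fin 𝓣.num) : IsCompact (𝓣.face e) :=
  (𝓣.isCompact_elem e.1).inter (𝓣.isCompact_elem e.2)

theorem face_swap (e : Fin 𝓣.num × Fin 𝓣.num) : 𝓣.face e.swap = 𝓣.face e := inter_comm _ _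

theorem isFiniteMeasure_restrict_face {e : Fin 𝓣.num × Fin 𝓣.num} (he : e.1 ≠ e.2) :
    IsFiniteMeasure ((Measure.euclideanHausdorffMeasure (d - 1) : Measure (Pt d)).restrict
      (𝓣.face e)) := by
  have h := euclideanHausdorffMeasure_lt_top_of_isCompact (𝓣.normal_spec he).1 (𝓣.isCompact_face e)
    fun x hx y hy => (𝓣.normal_spec he).inner_sub_eq_zero hx hy
  rw [finrank_euclideanSpace_fin] at h
  exact isFiniteMeasure_restrict.mpr h.ne

/-- The `(d - 1)`-dimensional measure is not locally finite on the whole space, so compactness is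
combined with finiteness of the measure restricted to the face. -/
theorem integrableOn_face {e : Fin 𝓣.num × Fin 𝓣.num} (he : e.1 ≠ e.2) {f : Pt d → ℝ}
    (hf : Continuous f) :
    IntegrableOn f (𝓣.face e) (Measure.euclideanHausdorffMeasure (d - 1)) := by
  have := 𝓣.isFiniteMeasure_restrict_face he
  have h := hf.continuousOn.integrableOn_compact (𝓣.isCompact_face e)
    (μ := (Measure.euclideanHausdorffMeasure (d - 1) : Measure (Pt d)).restrict (𝓣.face e))
  rwa [IntegrableOn, Measure.restrict_restrict (𝓣.isCompact_face e).measurableSet,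
    inter_self] at h

/-- Trace inequality from the interfaces of an element to the element. -/
theorem sum_lintegral_face_le {r : ℕ} {κ K : ℝ} (h𝓣 : 𝓣.ShapeRegular κ) (hK0 : 0 ≤ K)
    (hK : ∀ q : Polynomial ℝ, q.natDegree ≤ r →
      (q.eval 1) ^ 2 ≤ K * ∫ s in (0 : ℝ)..1, s ^ (d - 1) * (q.eval s) ^ 2)
    (i : Fin 𝓣.num) {g : Pt d → ℝ} (hg : Continuous g)
    (hgr : ∀ x y, ∃ q : Polynomial ℝ, q.natDegree ≤ r ∧
      ∀ s, q.eval s = g (AffineMap.lineMap x y s)) :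
    ∑ j ∈ Finset.univ.erase i, ENNReal.ofReal (Metric.diam (𝓣.face (i, j))) *
        ∫⁻ x in 𝓣.face (i, j), ENNReal.ofReal (g x ^ 2)
          ∂(Measure.euclideanHausdorffMeasure (d - 1))
      ≤ ENNReal.ofReal (κ * K) * ∫⁻ x in 𝓣.elem i, ENNReal.ofReal (g x ^ 2) := by
  obtain ⟨x₀, ρ, hρ, hball, hdiam⟩ := h𝓣 i
  have hκ : 0 ≤ κ := nonneg_of_mul_nonneg_left (Metric.diam_nonneg.trans hdiam) hρ
  have hfr : finrank ℝ (Pt d) - 1 = d - 1 := by rw [finrank_euclideanSpace_fin]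
  have hx₀ : x₀ ∈ interior (𝓣.elem i) :=
    mem_interior.mpr ⟨_, hball, Metric.isOpen_ball, Metric.mem_ball_self hρ⟩
  have hnormal : ∀ j ∈ Finset.univ.erase i,
      IsInterfaceNormal (𝓣.elem i) (𝓣.elem j) (𝓣.normal (i, j)) := fun j hj =>
    𝓣.normal_spec (e := (i, j)) (Finset.ne_of_mem_erase hj).symm
  -- the plane of each interface is at distance at least `ρ` of `x₀`
  have hplane : ∀ j ∈ Finset.univ.erase i, ∃ δ, ρ ≤ δ ∧
      ∀ y ∈ 𝓣.face (i, j), inner ℝ (𝓣.normal (i, j)) (y - x₀) = δ := by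
    intro j hj
    rcases (𝓣.face (i, j)).eq_empty_or_nonempty with he | ⟨y₀, hy₀⟩
    · exact ⟨ρ, le_rfl, by simp [he]⟩
    · refine ⟨_, (hnormal j hj).le_inner_sub hρ hball hy₀, fun y hy => ?_⟩
      rw [← sub_eq_zero, ← inner_sub_right, sub_sub_sub_cancel_right]
      exact (hnormal j hj).inner_sub_eq_zero hy hy₀
  have hcone : ∀ j ∈ Finset.univ.erase i,
      ENNReal.ofReal (Metric.diam (𝓣.face (i, j))) *
        ∫⁻ x in 𝓣.face (i, j), ENNReal.ofReal (g x ^ 2)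
          ∂(Measure.euclideanHausdorffMeasure (d - 1))
      ≤ ENNReal.ofReal (κ * K) *
        ∫⁻ x in convexJoin ℝ {x₀} (𝓣.face (i, j)), ENNReal.ofReal (g x ^ 2) := by
    intro j hj
    obtain ⟨δ, hρδ, hδ⟩ := hplane j hj
    have h1 := lintegral_sq_le_lintegral_convexJoin hK0 (hfr ▸ hK) (hnormal j hj).1
      (hρ.trans_le hρδ) (𝓣.isCompact_face (i, j)) hδ hg (hgr x₀)
    rw [hfr] at h1
    -- The height of the cone compensates the weight: `h_e ≤ diam K_i ≤ κ ρ ≤ κ δ`.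
    have h2 : Metric.diam (𝓣.face (i, j)) ≤ κ * δ :=
      (Metric.diam_mono inter_subset_left (𝓣.isCompact_elem i).isBounded).trans
        (hdiam.trans (by gcongr))
    rw [ENNReal.ofReal_mul hκ, mul_assoc]
    refine le_trans ?_ (mul_le_mul_right h1 _)
    rw [← mul_assoc, ← ENNReal.ofReal_mul hκ]
    gcongr
  refine (Finset.sum_le_sum hcone).trans ?_
  rw [← Finset.mul_sum]
  refine mul_le_mul_right ?_ _
  -- The cones are disjoint up to null sets, so the sum of the integrals is the integral over their
  -- union, which is contained in the element by convexity.
  rw [← lintegral_biUnion_finset₀ (fun j hj k hk hjk => ?_)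
    (fun j _ => (isCompact_convexJoin_singleton
      (𝓣.isCompact_face (i, j))).measurableSet.nullMeasurableSet)]
  · refine lintegral_mono_set (iUnion₂_subset fun j _ => ?_)
    intro x hx
    obtain ⟨y, hy, s, hs, rfl⟩ := mem_convexJoin_singleton.mp hx
    exact (𝓣.convex_elem i).lineMap_mem (hball (Metric.mem_ball_self hρ)) hy.1 hs
  · have hd : d ≠ 0 := by
      rintro rfl
      have := (hnormal j hj).1
      rw [Subsingleton.elim (𝓣.normal (i, j)) 0, norm_zero] at this
      exact zero_ne_one this
    have : Nonempty (Fin d) := ⟨⟨0, Nat.pos_of_ne_zero hd⟩⟩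
    obtain ⟨δ, hρδ, hδ⟩ := hplane j hj
    refine measure_mono_null ((hnormal j hj).convexJoin_inter_subset (hnormal k hk) hx₀) ?_
    refine measure_union_null (measure_singleton x₀) ?_
    refine volume_convexJoin_eq_zero (hnormal j hj).1 (hρ.trans_le hρδ)
      ((𝓣.isCompact_face (i, j)).inter (𝓣.isCompact_face (i, k)))
      (fun y hy => hδ y hy.1) ?_
    rw [hfr]
    exact (hnormal j hj).euclideanHausdorffMeasure_inter_eq_zero (hnormal k hk)
      (𝓣.isCompact_elem i) (𝓣.isCompact_elem j) (𝓣.isCompact_elem k) (𝓣.convex_elem i)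
      (𝓣.convex_elem j) (𝓣.convex_elem k) ⟨x₀, hx₀⟩ (𝓣.interior_nonempty j)
      (𝓣.interior_nonempty k) (𝓣.disjoint_interior j k hjk)

end Mesh

end GLDG

/-! ### Polynomials in coordinates, and traces of gradients. -/

theorem MvPolynomial.pderiv_mem_restrictTotalDegree {σ R : Type*} [CommSemiring R] {r : ℕ}
    {p : MvPolynomial σ R} (hp : p ∈ MvPolynomial.restrictTotalDegree σ R r) (k : σ) :
    MvPolynomial.pderiv k p ∈ MvPolynomial.restrictTotalDegree σ R r := by
  rw [mem_restrictTotalDegree] at hp ⊢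
  refine Finset.sup_le fun s hs => ?_
  rw [mem_support_iff, coeff_pderiv] at hs
  have h := le_totalDegree (mem_support_iff.mpr (left_ne_zero_of_mul hs))
  rw [Finsupp.sum_add_index' (fun _ => rfl) (fun _ _ _ => rfl)] at h
  omega

namespace GLDG

variable {d r : ℕ}

/-- A finite set of exponents containing all monomials of total degree at most `r`. -/
noncomputable def exponents (d r : ℕ) : Finset (Fin d →₀ ℕ) :=
  Finset.Iic (Finsupp.equivFunOnFinite.symm fun _ => r)

/-- The index set does not depend on `p`, so continuity and differentiability in time can be read
off the coefficients. -/
theorem polyVal_eq_sum {p : MvPolynomial (Fin d) ℝ}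
    (hp : p ∈ MvPolynomial.restrictTotalDegree (Fin d) ℝ r) (x : Pt d) :
    polyVal p x = ∑ m ∈ exponents d r, p.coeff m * ∏ k, x k ^ m k := by
  rw [polyVal, MvPolynomial.eval_eq']
  refine Finset.sum_subset (fun m hm => ?_) fun m _ hm => ?_
  · rw [MvPolynomial.mem_restrictTotalDegree] at hp
    refine Finset.mem_Iic.mpr fun k => ?_
    exact (Finsupp.le_degree k m).trans ((MvPolynomial.le_totalDegree hm).trans hp)
  · rw [MvPolynomial.notMem_support_iff.mp hm, zero_mul]

theorem continuous_polyVal (p : MvPolynomial (Fin d) ℝ) : Continuous (polyVal p) := by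
  have h : polyVal p = fun x : Pt d => ∑ m ∈ p.support, p.coeff m * ∏ k, x k ^ m k :=
    funext fun x => MvPolynomial.eval_eq' _ _
  rw [h]
  fun_prop

theorem continuous_polyGrad (p : MvPolynomial (Fin d) ℝ) : Continuous (polyGrad p) := by
  unfold polyGrad
  have := fun k => continuous_polyVal (MvPolynomial.pderiv k p)
  fun_prop

/-- Along a line, a polynomial is a polynomial in one variable. -/
theorem exists_eval_eq_polyVal_lineMap {p : MvPolynomial (Fin d) ℝ}
    (hp : p ∈ MvPolynomial.restrictTotalDegree (Fin d) ℝ r) (x y : Pt d) :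
    ∃ q : Polynomial ℝ, q.natDegree ≤ r ∧
      ∀ s, q.eval s = polyVal p (AffineMap.lineMap x y s) := by
  refine ⟨MvPolynomial.aeval
    (fun k => Polynomial.X * Polynomial.C (y k - x k) + Polynomial.C (x k)) p, ?_, fun s => ?_⟩
  · rw [MvPolynomial.mem_restrictTotalDegree] at hp
    refine (MvPolynomial.aeval_natDegree_le p hp _ (n := 1) fun k => ?_).trans_eq (mul_one r)
    compute_degree
  · rw [polyVal, MvPolynomial.aeval_def, MvPolynomial.polynomial_eval_eval₂, MvPolynomial.eval,
      MvPolynomial.coe_eval₂Hom]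
    congr 1
    · ext
      simp
    · ext k
      simp [AffineMap.lineMap_apply]

theorem norm_polyGrad_sq (p : MvPolynomial (Fin d) ℝ) (x : Pt d) :
    ‖polyGrad p x‖ ^ 2 = ∑ k, polyVal (MvPolynomial.pderiv k p) x ^ 2 := by
  rw [EuclideanSpace.real_norm_sq_eq]
  rfl

namespace Mesh

variable {Ω : Set (Pt d)} (𝓣 : Mesh Ω)

theorem continuous_val (u : 𝓣.Vh r) (i : Fin 𝓣.num) : Continuous (𝓣.val u i) :=
  continuous_polyVal _

theorem continuous_grad (u : 𝓣.Vh r) (i : Fin 𝓣.num) : Continuous (𝓣.grad u i) :=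
  continuous_polyGrad _

theorem continuous_avgGrad (u : 𝓣.Vh r) (e : Fin 𝓣.num × Fin 𝓣.num) :
    Continuous (𝓣.avgGrad u e) := by
  have h1 := 𝓣.continuous_grad u e.1
  have h2 := 𝓣.continuous_grad u e.2
  unfold avgGrad
  fun_prop

theorem continuous_jump (u : 𝓣.Vh r) (e : Fin 𝓣.num × Fin 𝓣.num) :
    Continuous (𝓣.jump u e) := by
  have h1 := 𝓣.continuous_val u e.1
  have h2 := 𝓣.continuous_val u e.2
  unfold jump
  fun_prop

theorem integrableOn_elem (i : Fin 𝓣.num) {f : Pt d → ℝ} (hf : Continuous f) :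
    IntegrableOn f (𝓣.elem i) :=
  hf.continuousOn.integrableOn_compact (𝓣.isCompact_elem i)

theorem fst_ne_snd_of_mem_intFaces {e : Fin 𝓣.num × Fin 𝓣.num} (he : e ∈ 𝓣.intFaces) :
    e.1 ≠ e.2 :=
  (Finset.mem_filter.mp he).2.1.ne

/-- A face has dimension `d - 1 ≥ 1`, hence is not a single point; this makes `1 / h_e` meaningful.
-/
theorem diam_face_pos (hd : 2 ≤ d) {e : Fin 𝓣.num × Fin 𝓣.num} (he : e ∈ 𝓣.intFaces) :
    0 < Metric.diam (𝓣.face e) := by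
  have hrank := (Finset.mem_filter.mp he).2.2
  refine Metric.diam_pos ?_ (𝓣.isCompact_face e).isBounded
  by_contra hsub
  rw [not_nontrivial_iff] at hsub
  rw [vectorSpan_of_subsingleton ℝ hsub, finrank_bot] at hrank
  omega

/-- Trace inequality from the interfaces of an element to the element, for the gradient. -/
theorem sum_diam_mul_faceInt_grad_le {κ K : ℝ} (h𝓣 : 𝓣.ShapeRegular κ) (hK0 : 0 ≤ K)
    (hK : ∀ q : Polynomial ℝ, q.natDegree ≤ r →
      (q.eval 1) ^ 2 ≤ K * ∫ s in (0 : ℝ)..1, s ^ (d - 1) * (q.eval s) ^ 2)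
    (w : 𝓣.Vh r) (i : Fin 𝓣.num) :
    ∑ j ∈ Finset.univ.erase i, Metric.diam (𝓣.face (i, j)) *
        𝓣.faceInt (i, j) (fun x => ‖𝓣.grad w i x‖ ^ 2)
      ≤ |κ| * K * ∫ x in 𝓣.elem i, ‖𝓣.grad w i x‖ ^ 2 := by
  -- The scalar trace inequality is applied to each partial derivative. Writing `|κ|` keeps the
  -- constant nonnegative even for a mesh without elements.
  have hcomp : ∀ k, ∑ j ∈ Finset.univ.erase i, Metric.diam (𝓣.face (i, j)) *
        𝓣.faceInt (i, j) (fun x => polyVal (MvPolynomial.pderiv k (w i).1) x ^ 2)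
      ≤ |κ| * K * ∫ x in 𝓣.elem i, polyVal (MvPolynomial.pderiv k (w i).1) x ^ 2 := by
    intro k
    have hg := continuous_polyVal (MvPolynomial.pderiv k (w i).1)
    have hg2 : Continuous fun x => polyVal (MvPolynomial.pderiv k (w i).1) x ^ 2 := hg.pow 2
    have h := 𝓣.sum_lintegral_face_le h𝓣 hK0 hK i hg
      (exists_eval_eq_polyVal_lineMap (MvPolynomial.pderiv_mem_restrictTotalDegree (w i).2 k))
    rw [← ENNReal.ofReal_le_ofReal_iff (by positivity), ENNReal.ofReal_sum_of_nonneg,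
      ENNReal.ofReal_mul (by positivity), ofReal_integral_eq_lintegral_ofReal
        (𝓣.integrableOn_elem i hg2) (ae_of_all _ fun x => sq_nonneg _)]
    · refine le_trans (le_of_eq (Finset.sum_congr rfl fun j hj => ?_)) (h.trans ?_)
      · rw [ENNReal.ofReal_mul Metric.diam_nonneg, faceInt, ofReal_integral_eq_lintegral_ofReal
          (𝓣.integrableOn_face (e := (i, j)) (Finset.ne_of_mem_erase hj).symm hg2)
          (ae_of_all _ fun x => sq_nonneg _)]
      · gcongr
        exact le_abs_self κ
    · exact fun j _ => mul_nonneg Metric.diam_nonneg (integral_nonneg fun x => sq_nonneg _)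
  have hc : ∀ k, Continuous fun x => polyVal (MvPolynomial.pderiv k (w i).1) x ^ 2 :=
    fun k => (continuous_polyVal _).pow 2
  simp only [grad, norm_polyGrad_sq]
  rw [integral_finsetSum _ fun k _ => 𝓣.integrableOn_elem i (hc k), Finset.mul_sum]
  refine le_trans (le_of_eq ?_) (Finset.sum_le_sum fun k _ => hcomp k)
  rw [Finset.sum_comm]
  refine Finset.sum_congr rfl fun j hj => ?_
  rw [faceInt, integral_finsetSum _ fun k _ => 𝓣.integrableOn_face (e := (i, j))
    (Finset.ne_of_mem_erase hj).symm (hc k), Finset.mul_sum]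
  rfl

/-- The trace inequality for the gradient, summed over all interior faces. -/
theorem sum_intFaces_diam_mul_faceInt_grad_le {κ K : ℝ} (h𝓣 : 𝓣.ShapeRegular κ) (hK0 : 0 ≤ K)
    (hK : ∀ q : Polynomial ℝ, q.natDegree ≤ r →
      (q.eval 1) ^ 2 ≤ K * ∫ s in (0 : ℝ)..1, s ^ (d - 1) * (q.eval s) ^ 2) (w : 𝓣.Vh r) :
    ∑ e ∈ 𝓣.intFaces, Metric.diam (𝓣.face e) *
        𝓣.faceInt e (fun x => ‖𝓣.grad w e.1 x‖ ^ 2 + ‖𝓣.grad w e.2 x‖ ^ 2)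
      ≤ |κ| * K * 𝓣.integ (fun i x => ‖𝓣.grad w i x‖ ^ 2) := by
  classical
  set F : Fin 𝓣.num × Fin 𝓣.num → ℝ := fun e =>
    Metric.diam (𝓣.face e) * 𝓣.faceInt e (fun x => ‖𝓣.grad w e.1 x‖ ^ 2) with hF
  have hF0 : ∀ e, 0 ≤ F e := fun e =>
    mul_nonneg Metric.diam_nonneg (integral_nonneg fun x => sq_nonneg _)
  -- A face is listed once, as `(i, j)` with `i < j`. Adding the reversed pairs assigns each
  -- one-sided trace to its own element.
  have hswap : Disjoint 𝓣.intFaces (𝓣.intFaces.map (Equiv.prodComm _ _).toEmbedding) := by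
    rw [Finset.disjoint_left]
    intro e he he'
    obtain ⟨e', he'', rfl⟩ := Finset.mem_map.mp he'
    have h1 : e'.2 < e'.1 := (Finset.mem_filter.mp he).2.1
    exact lt_asymm h1 (Finset.mem_filter.mp he'').2.1
  calc _ = ∑ e ∈ 𝓣.intFaces, F e + ∑ e ∈ 𝓣.intFaces, F e.swap := by
        rw [← Finset.sum_add_distrib]
        refine Finset.sum_congr rfl fun e he => ?_
        have hne := 𝓣.fst_ne_snd_of_mem_intFaces he
        simp only [hF, faceInt, face_swap, Prod.fst_swap]
        have hc := fun i => (𝓣.continuous_grad w i).norm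
        rw [integral_add (𝓣.integrableOn_face hne (by fun_prop))
          (𝓣.integrableOn_face hne (by fun_prop)), mul_add]
    _ = ∑ e ∈ 𝓣.intFaces.disjUnion _ hswap, F e := by
        rw [Finset.sum_disjUnion, Finset.sum_map]
        rfl
    _ ≤ ∑ e : Fin 𝓣.num × Fin 𝓣.num with e.1 ≠ e.2, F e := by
        refine Finset.sum_le_sum_of_subset_of_nonneg (fun e he => ?_) fun e _ _ => hF0 e
        refine Finset.mem_filter.mpr ⟨Finset.mem_univ _, ?_⟩
        rcases Finset.mem_disjUnion.mp he with he | he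
        · exact 𝓣.fst_ne_snd_of_mem_intFaces he
        · obtain ⟨e', he', rfl⟩ := Finset.mem_map.mp he
          exact (𝓣.fst_ne_snd_of_mem_intFaces he').symm
    _ = ∑ i, ∑ j ∈ Finset.univ.erase i, F (i, j) := by
        rw [Finset.sum_filter, Fintype.sum_prod_type]
        refine Finset.sum_congr rfl fun i _ => ?_
        rw [← Finset.filter_ne, Finset.sum_filter]
    _ ≤ _ := by
        rw [integ, Finset.mul_sum]
        exact Finset.sum_le_sum fun i _ => 𝓣.sum_diam_mul_faceInt_grad_le h𝓣 hK0 hK w i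

/-! ### Coercivity of the interior penalty form. -/

/-- The consistency term of the interior penalty form. -/
noncomputable def fluxForm (u v : 𝓣.Vh r) : ℝ :=
  ∑ e ∈ 𝓣.intFaces, 𝓣.faceInt e (fun x => inner ℝ (𝓣.avgGrad u e x) (𝓣.jump v e x))

/-- The squared jump seminorm `∑_e h_e⁻¹ ∫_e |[v]|²`. -/
noncomputable def jumpSq (v : 𝓣.Vh r) : ℝ :=
  ∑ e ∈ 𝓣.intFaces, (Metric.diam (𝓣.face e))⁻¹ * 𝓣.faceInt e (fun x => ‖𝓣.jump v e x‖ ^ 2)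

/-- Young's inequality with weight `ε h_e` on each face: the factor `h_e` is what the trace
inequality needs, and `h_e⁻¹` is the weight of the penalty. -/
theorem abs_fluxForm_le (hd : 2 ≤ d) {κ K : ℝ} (h𝓣 : 𝓣.ShapeRegular κ) (hK0 : 0 ≤ K)
    (hK : ∀ q : Polynomial ℝ, q.natDegree ≤ r →
      (q.eval 1) ^ 2 ≤ K * ∫ s in (0 : ℝ)..1, s ^ (d - 1) * (q.eval s) ^ 2)
    {ε : ℝ} (hε : 0 < ε) (u v : 𝓣.Vh r) :
    |𝓣.fluxForm u v| ≤ ε / 2 * (|κ| * K * 𝓣.integ (fun i x => ‖𝓣.grad u i x‖ ^ 2))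
      + 1 / (4 * ε) * 𝓣.jumpSq v := by
  refine le_trans ?_ (add_le_add_left (mul_le_mul_of_nonneg_left
    (𝓣.sum_intFaces_diam_mul_faceInt_grad_le h𝓣 hK0 hK u) (by positivity)) _)
  rw [fluxForm, jumpSq, Finset.mul_sum, Finset.mul_sum, ← Finset.sum_add_distrib]
  refine (Finset.abs_sum_le_sum_abs _ _).trans (Finset.sum_le_sum fun e he => ?_)
  have hne := 𝓣.fst_ne_snd_of_mem_intFaces he
  have hh := 𝓣.diam_face_pos hd he
  set h := Metric.diam (𝓣.face e)
  have hc1 := 𝓣.continuous_grad u e.1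
  have hc2 := 𝓣.continuous_grad u e.2
  have hc3 := 𝓣.continuous_jump v e
  have hc4 := 𝓣.continuous_avgGrad u e
  simp only [faceInt]
  rw [← mul_assoc, ← mul_assoc, ← integral_const_mul, ← integral_const_mul,
    ← integral_add (𝓣.integrableOn_face hne (by fun_prop))
      (𝓣.integrableOn_face hne (by fun_prop))]
  refine (abs_integral_le_integral_abs).trans (integral_mono
    (𝓣.integrableOn_face hne (by fun_prop)) (𝓣.integrableOn_face hne (by fun_prop)) fun x => ?_)
  set a := 𝓣.avgGrad u e x with ha
  set j := 𝓣.jump v e x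
  have h1 : |inner ℝ a j| ≤ ‖a‖ * ‖j‖ := abs_real_inner_le_norm _ _
  have h2 : ‖a‖ ^ 2 ≤ (‖𝓣.grad u e.1 x‖ ^ 2 + ‖𝓣.grad u e.2 x‖ ^ 2) / 2 := by
    rw [ha, avgGrad, norm_smul, Real.norm_of_nonneg (by norm_num)]
    have := norm_add_le (𝓣.grad u e.1 x) (𝓣.grad u e.2 x)
    have h0 := norm_nonneg (𝓣.grad u e.1 x + 𝓣.grad u e.2 x)
    nlinarith [sq_nonneg (‖𝓣.grad u e.1 x‖ - ‖𝓣.grad u e.2 x‖)]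
  have h3 : ‖a‖ * ‖j‖ ≤ ε * h * ‖a‖ ^ 2 + 1 / (4 * ε) * h⁻¹ * ‖j‖ ^ 2 := by
    have h4 : ε * h * ‖a‖ ^ 2 + 1 / (4 * ε) * h⁻¹ * ‖j‖ ^ 2 - ‖a‖ * ‖j‖
        = (2 * ε * h * ‖a‖ - ‖j‖) ^ 2 / (4 * ε * h) := by
      field_simp
      ring
    have h5 : 0 ≤ (2 * ε * h * ‖a‖ - ‖j‖) ^ 2 / (4 * ε * h) := by positivity
    linarith
  have h6 : ε * h * ‖a‖ ^ 2
      ≤ ε * h * ((‖𝓣.grad u e.1 x‖ ^ 2 + ‖𝓣.grad u e.2 x‖ ^ 2) / 2) := by gcongr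
  calc |inner ℝ a j| ≤ _ := h1.trans h3
    _ ≤ ε / 2 * h * (‖𝓣.grad u e.1 x‖ ^ 2 + ‖𝓣.grad u e.2 x‖ ^ 2)
        + 1 / (4 * ε) * h⁻¹ * ‖j‖ ^ 2 := by linarith

theorem jumpSq_nonneg (v : 𝓣.Vh r) : 0 ≤ 𝓣.jumpSq v :=
  Finset.sum_nonneg fun _ _ => mul_nonneg (inv_nonneg.mpr Metric.diam_nonneg)
    (integral_nonneg fun _ => sq_nonneg _)

theorem integ_norm_grad_sq_nonneg (v : 𝓣.Vh r) :
    0 ≤ 𝓣.integ (fun i x => ‖𝓣.grad v i x‖ ^ 2) :=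
  Finset.sum_nonneg fun _ _ => integral_nonneg fun _ => sq_nonneg _

theorem ah_self (θ σ : ℝ) (u : 𝓣.Vh r) :
    𝓣.ah θ σ u u = 𝓣.integ (fun i x => ‖𝓣.grad u i x‖ ^ 2) - (1 - θ) * 𝓣.fluxForm u u
      + σ * 𝓣.jumpSq u := by
  have h : ∀ e, 𝓣.faceInt e (fun x => σ / Metric.diam (𝓣.face e) *
      inner ℝ (𝓣.jump u e x) (𝓣.jump u e x))
      = σ * ((Metric.diam (𝓣.face e))⁻¹ * 𝓣.faceInt e (fun x => ‖𝓣.jump u e x‖ ^ 2)) := by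
    intro e
    simp only [faceInt, real_inner_self_eq_norm_sq]
    rw [integral_const_mul, div_eq_mul_inv, mul_assoc]
  simp only [ah, h, fluxForm, jumpSq, ← Finset.mul_sum]
  simp only [real_inner_self_eq_norm_sq]
  ring

/-- The volume and penalty terms are symmetric and cancel, so the contribution of `α` does not grow
with `σ`. -/
theorem ah_sub_ah_comm (θ σ : ℝ) (u v : 𝓣.Vh r) :
    𝓣.ah θ σ u v - 𝓣.ah θ σ v u = (1 + θ) * (𝓣.fluxForm v u - 𝓣.fluxForm u v) := by
  have h1 : 𝓣.integ (fun i x => inner ℝ (𝓣.grad v i x) (𝓣.grad u i x))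
      = 𝓣.integ (fun i x => inner ℝ (𝓣.grad u i x) (𝓣.grad v i x)) := by
    simp only [real_inner_comm]
  have h2 : ∀ e, 𝓣.faceInt e (fun x => σ / Metric.diam (𝓣.face e) *
        inner ℝ (𝓣.jump v e x) (𝓣.jump u e x))
      = 𝓣.faceInt e (fun x => σ / Metric.diam (𝓣.face e) *
        inner ℝ (𝓣.jump u e x) (𝓣.jump v e x)) := by
    intro e
    simp only [real_inner_comm]
  simp only [ah, h1, h2, fluxForm]
  ring

/-- Coercivity of the interior penalty form of the complex operator `(1 + iα) Δ`, for a penalty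
parameter which depends only on the dimension, the degree, the shape regularity and `α`. -/
theorem exists_forall_ah_nonneg (hd : 2 ≤ d) (r : ℕ) (κ α : ℝ) :
    ∃ σ₀ : ℝ, 0 < σ₀ ∧ ∀ σ, σ₀ ≤ σ → ∀ θ : ℝ, |θ| ≤ 1 → ∀ {Ω : Set (Pt d)} (𝓣 : Mesh Ω),
      𝓣.ShapeRegular κ → ∀ u₁ u₂ : 𝓣.Vh r,
      0 ≤ 𝓣.ah θ σ u₁ u₁ + 𝓣.ah θ σ u₂ u₂ - α * (𝓣.ah θ σ u₂ u₁ - 𝓣.ah θ σ u₁ u₂) := by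
  obtain ⟨K, hK0, hK⟩ := Polynomial.exists_sq_eval_one_le_integral (d - 1) r
  -- Small enough for the face terms to use at most the whole gradient norm, see `hε1`; the `+ 1`
  -- avoids a zero denominator.
  set ε : ℝ := 1 / ((1 + |α|) * (|κ| * K + 1)) with hεdef
  have hα := abs_nonneg α
  have hε : 0 < ε := by positivity
  have hε1 : (1 + |α|) * ε * (|κ| * K) ≤ 1 := by
    have : (1 + |α|) * ε * (|κ| * K) = (|κ| * K) / (|κ| * K + 1) := by
      rw [hεdef]
      field_simp
    rw [this, div_le_one (by positivity)]
    linarith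
  -- The jump terms produced by Young's inequality have total coefficient `2 (1 + |α|) / (4 ε)`,
  -- where `2` bounds `|1 - θ|` and `|1 + θ|`.
  refine ⟨(1 + |α|) / (2 * ε), by positivity, fun σ hσ θ hθ Ω 𝓣 h𝓣 u₁ u₂ => ?_⟩
  rw [ah_self, ah_self, ah_sub_ah_comm]
  have hB := fun u v : 𝓣.Vh r => 𝓣.abs_fluxForm_le hd h𝓣 hK0 hK hε u v
  have hB11 := hB u₁ u₁
  have hB12 := hB u₁ u₂
  have hB21 := hB u₂ u₁
  have hB22 := hB u₂ u₂
  have hJ1 := 𝓣.jumpSq_nonneg u₁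
  have hJ2 := 𝓣.jumpSq_nonneg u₂
  have hG1 := 𝓣.integ_norm_grad_sq_nonneg u₁
  have hG2 := 𝓣.integ_norm_grad_sq_nonneg u₂
  set G₁ := 𝓣.integ (fun i x => ‖𝓣.grad u₁ i x‖ ^ 2)
  set G₂ := 𝓣.integ (fun i x => ‖𝓣.grad u₂ i x‖ ^ 2)
  set J₁ := 𝓣.jumpSq u₁
  set J₂ := 𝓣.jumpSq u₂
  rw [abs_le] at hθ
  have hmul : ∀ {a x y : ℝ}, |a| ≤ y → |x| ≤ 2 → x * a ≤ 2 * y := by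
    intro a x y ha hx
    calc x * a ≤ |x * a| := le_abs_self _
      _ = |x| * |a| := abs_mul _ _
      _ ≤ 2 * y := by gcongr
  have hm : |1 - θ| ≤ 2 := by rw [abs_le]; constructor <;> linarith
  have hp : |1 + θ| ≤ 2 := by rw [abs_le]; constructor <;> linarith
  have e1 := hmul hB11 hm
  have e2 := hmul hB22 hm
  have e3 : α * ((1 + θ) * (𝓣.fluxForm u₁ u₂ - 𝓣.fluxForm u₂ u₁))
      ≤ |α| * (2 * ((ε / 2 * (|κ| * K * G₁) + 1 / (4 * ε) * J₂)
        + (ε / 2 * (|κ| * K * G₂) + 1 / (4 * ε) * J₁))) := by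
    refine (le_abs_self _).trans ?_
    rw [abs_mul, abs_mul]
    have := (abs_sub (𝓣.fluxForm u₁ u₂) (𝓣.fluxForm u₂ u₁)).trans (add_le_add hB12 hB21)
    gcongr
  have e4 : (1 + |α|) * ε * (|κ| * K) * (G₁ + G₂) ≤ 1 * (G₁ + G₂) := by gcongr
  have e5 : (1 + |α|) / (2 * ε) * (J₁ + J₂) ≤ σ * (J₁ + J₂) := by gcongr
  have e6 : (1 + |α|) / (2 * ε) * (J₁ + J₂)
      = (1 + |α|) * 2 * (1 / (4 * ε)) * (J₁ + J₂) := by field_simp; ring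
  rw [e6] at e5
  linarith

end Mesh

end GLDG

/-- A discrete Grönwall inequality. -/
theorem le_mul_pow_add_of_forall_le_mul_add {a : ℕ → ℝ} {C D : ℝ} {N : ℕ} (hC : 0 ≤ C)
    (h : ∀ n < N, a (n + 1) ≤ C * a n + D) :
    a N ≤ a 0 * C ^ N + D * ∑ k ∈ Finset.range N, C ^ k := by
  have key : ∀ n ≤ N, a n ≤ a 0 * C ^ n + D * ∑ k ∈ Finset.range n, C ^ k := by
    intro n
    induction n with
    | zero => simp
    | succ n ih =>
      intro hn
      rw [Finset.sum_range_succ', pow_zero]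
      have h1 := mul_le_mul_of_nonneg_left (ih (Nat.le_of_succ_le hn)) hC
      have h2 : ∑ k ∈ Finset.range n, C ^ (k + 1) = C * ∑ k ∈ Finset.range n, C ^ k := by
        rw [Finset.mul_sum]
        exact Finset.sum_congr rfl fun k _ => pow_succ' C k
      rw [h2, pow_succ']
      linarith [h n hn]
  exact key N le_rfl

/-! ### Regularity in time and the energy estimate. -/

namespace GLDG

variable {d r : ℕ}

theorem continuous_uncurry_polyVal {X : Type*} [TopologicalSpace X]
    {p : X → MvPolynomial (Fin d) ℝ}
    (hp : ∀ a, p a ∈ MvPolynomial.restrictTotalDegree (Fin d) ℝ r)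
    (hc : ∀ m, Continuous fun a => (p a).coeff m) :
    Continuous fun z : X × Pt d => polyVal (p z.1) z.2 := by
  simp only [fun a => polyVal_eq_sum (hp a)]
  have := fun m => (hc m).comp continuous_fst (X := X × Pt d)
  simp only [Function.comp_def] at this
  fun_prop

theorem continuous_uncurry_polyGrad {X : Type*} [TopologicalSpace X]
    {p : X → MvPolynomial (Fin d) ℝ}
    (hp : ∀ a, p a ∈ MvPolynomial.restrictTotalDegree (Fin d) ℝ r)
    (hc : ∀ m, Continuous fun a => (p a).coeff m) :
    Continuous fun z : X × Pt d => polyGrad (p z.1) z.2 := by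
  have h : ∀ k, Continuous fun z : X × Pt d =>
      polyVal (MvPolynomial.pderiv k (p z.1)) z.2 := fun k => by
    refine continuous_uncurry_polyVal (p := fun a => MvPolynomial.pderiv k (p a))
      (fun a => MvPolynomial.pderiv_mem_restrictTotalDegree (hp a) k) fun m => ?_
    simp only [MvPolynomial.coeff_pderiv]
    exact (hc _).mul continuous_const
  unfold polyGrad
  fun_prop

namespace Mesh

variable {Ω : Set (Pt d)} (𝓣 : Mesh Ω)

/-- Convex sets have null frontiers, and the interiors are disjoint subsets of `Ω`. This makes the
final constant independent of the mesh. -/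
theorem sum_volume_elem_le (hΩ : Bornology.IsBounded Ω) :
    ∑ i, volume.real (𝓣.elem i) ≤ volume.real Ω := by
  have h : ∀ i, volume.real (𝓣.elem i) = volume.real (interior (𝓣.elem i)) := fun i => by
    refine measureReal_congr ?_
    exact (interior_ae_eq_of_null_frontier ((𝓣.convex_elem i).addHaar_frontier volume)).symm
  simp only [h]
  rw [← measureReal_iUnion_fintype (fun i j hij => 𝓣.disjoint_interior i j hij)
    (fun i => isOpen_interior.measurableSet)
    (fun i => ((measure_mono (𝓣.interior_subset i)).trans_lt hΩ.measure_lt_top).ne)]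
  exact measureReal_mono (iUnion_subset 𝓣.interior_subset) hΩ.measure_lt_top.ne

theorem continuous_uncurry_val {X : Type*} [TopologicalSpace X] {u : X → 𝓣.Vh r}
    (hu : ∀ i m, Continuous fun a => (u a i).1.coeff m) (i : Fin 𝓣.num) :
    Continuous fun z : X × Pt d => 𝓣.val (u z.1) i z.2 :=
  continuous_uncurry_polyVal (p := fun a => (u a i).1) (fun a => (u a i).2) (hu i)

theorem continuous_uncurry_grad {X : Type*} [TopologicalSpace X] {u : X → 𝓣.Vh r}
    (hu : ∀ i m, Continuous fun a => (u a i).1.coeff m) (i : Fin 𝓣.num) :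
    Continuous fun z : X × Pt d => 𝓣.grad (u z.1) i z.2 :=
  continuous_uncurry_polyGrad (p := fun a => (u a i).1) (fun a => (u a i).2) (hu i)

section Continuity

variable {X : Type*} [TopologicalSpace X] [FirstCountableTopology X] [LocallyCompactSpace X]

theorem continuous_integ {F : X → Fin 𝓣.num → Pt d → ℝ}
    (hF : ∀ i, Continuous fun z : X × Pt d => F z.1 i z.2) :
    Continuous fun a => 𝓣.integ (F a) :=
  continuous_finsetSum _ fun i _ =>
    continuous_parametric_integral_of_continuous (f := fun a x => F a i x) (hF i)
      (𝓣.isCompact_elem i)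

theorem continuous_faceInt {e : Fin 𝓣.num × Fin 𝓣.num} (he : e ∈ 𝓣.intFaces)
    {F : X → Pt d → ℝ} (hF : Continuous fun z : X × Pt d => F z.1 z.2) :
    Continuous fun a => 𝓣.faceInt e (F a) := by
  have := 𝓣.isFiniteMeasure_restrict_face (𝓣.fst_ne_snd_of_mem_intFaces he)
  have h := continuous_parametric_integral_of_continuous
    (μ := (Measure.euclideanHausdorffMeasure (d - 1) : Measure (Pt d)).restrict (𝓣.face e))
    (f := F) hF (𝓣.isCompact_face e)
  rwa [Measure.restrict_restrict (𝓣.isCompact_face e).measurableSet, inter_self] at h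

theorem continuous_ah (θ σ : ℝ) {u v : X → 𝓣.Vh r}
    (hu : ∀ i m, Continuous fun a => (u a i).1.coeff m)
    (hv : ∀ i m, Continuous fun a => (v a i).1.coeff m) :
    Continuous fun a => 𝓣.ah θ σ (u a) (v a) := by
  have hu1 := 𝓣.continuous_uncurry_val hu
  have hv1 := 𝓣.continuous_uncurry_val hv
  have hu2 := 𝓣.continuous_uncurry_grad hu
  have hv2 := 𝓣.continuous_uncurry_grad hv
  have hj : ∀ {w : X → 𝓣.Vh r}, (∀ i, Continuous fun z : X × Pt d => 𝓣.val (w z.1) i z.2) →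
      ∀ e, Continuous fun z : X × Pt d => 𝓣.jump (w z.1) e z.2 := fun hw e =>
    ((hw e.1).smul continuous_const).add ((hw e.2).smul continuous_const)
  have hg : ∀ {w : X → 𝓣.Vh r}, (∀ i, Continuous fun z : X × Pt d => 𝓣.grad (w z.1) i z.2) →
      ∀ e, Continuous fun z : X × Pt d => 𝓣.avgGrad (w z.1) e z.2 := fun hw e =>
    ((hw e.1).add (hw e.2)).const_smul (1 / 2 : ℝ)
  have h1 := 𝓣.continuous_integ (F := fun a i x => inner ℝ (𝓣.grad (u a) i x) (𝓣.grad (v a) i x))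
    fun i => (hu2 i).inner (hv2 i)
  have h2 := continuous_finsetSum 𝓣.intFaces fun e he => 𝓣.continuous_faceInt he
    (F := fun a x => inner ℝ (𝓣.avgGrad (u a) e x) (𝓣.jump (v a) e x))
    ((hg hu2 e).inner (hj hv1 e))
  have h3 := continuous_finsetSum 𝓣.intFaces fun e he => 𝓣.continuous_faceInt he
    (F := fun a x => inner ℝ (𝓣.avgGrad (v a) e x) (𝓣.jump (u a) e x))
    ((hg hv2 e).inner (hj hu1 e))
  have h4 := continuous_finsetSum 𝓣.intFaces fun e he => 𝓣.continuous_faceInt he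
    (F := fun a x => σ / Metric.diam (𝓣.face e) *
      inner ℝ (𝓣.jump (u a) e x) (𝓣.jump (v a) e x))
    (continuous_const.mul ((hj hu1 e).inner (hj hv1 e)))
  exact ((h1.sub h2).add (continuous_const.mul h3)).add h4

end Continuity

variable {𝓣}

theorem TimeContinuousOn.restrict {u : ℝ → 𝓣.Vh r} {I : Set ℝ} (hu : 𝓣.TimeContinuousOn u I)
    (i : Fin 𝓣.num) (m : Fin d →₀ ℕ) : Continuous fun a : I => (u a i).1.coeff m :=
  (hu i m).domRestrict

theorem TimeContinuousOn.mono {u : ℝ → 𝓣.Vh r} {I J : Set ℝ} (hu : 𝓣.TimeContinuousOn u I)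
    (h : J ⊆ I) : 𝓣.TimeContinuousOn u J := fun i m => (hu i m).mono h

theorem HasTimeDerivOn.timeContinuousOn {u u' : ℝ → 𝓣.Vh r} {I : Set ℝ}
    (hu : 𝓣.HasTimeDerivOn u u' I) : 𝓣.TimeContinuousOn u I :=
  fun i m τ hτ => (hu.1 i m τ hτ).continuousWithinAt

variable (𝓣)

/-- A mass matrix constant in time: differentiating the norm becomes the product rule for
coefficients, with no differentiation under the integral. -/
theorem integ_val_mul_val (u v : 𝓣.Vh r) :
    𝓣.integ (fun i x => 𝓣.val u i x * 𝓣.val v i x)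
      = ∑ i, ∑ m ∈ exponents d r, ∑ l ∈ exponents d r, (u i).1.coeff m * (v i).1.coeff l *
        ∫ x in 𝓣.elem i, (∏ k, x k ^ m k) * ∏ k, x k ^ l k := by
  refine Finset.sum_congr rfl fun i _ => ?_
  have h : ∀ x, 𝓣.val u i x * 𝓣.val v i x
      = ∑ m ∈ exponents d r, ∑ l ∈ exponents d r, (u i).1.coeff m * (v i).1.coeff l *
        ((∏ k, x k ^ m k) * ∏ k, x k ^ l k) := by
    intro x
    rw [val, val, polyVal_eq_sum (u i).2, polyVal_eq_sum (v i).2, Finset.sum_mul_sum]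
    refine Finset.sum_congr rfl fun m _ => Finset.sum_congr rfl fun l _ => ?_
    ring
  simp only [h]
  rw [integral_finsetSum _ fun m _ => 𝓣.integrableOn_elem i (by fun_prop)]
  refine Finset.sum_congr rfl fun m _ => ?_
  rw [integral_finsetSum _ fun l _ => 𝓣.integrableOn_elem i (by fun_prop)]
  exact Finset.sum_congr rfl fun l _ => integral_const_mul _ _

theorem hasDerivAt_normSq {u u' : ℝ → 𝓣.Vh r} {τ : ℝ}
    (h : ∀ i m, HasDerivAt (fun ξ => (u ξ i).1.coeff m) ((u' τ i).1.coeff m) τ) :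
    HasDerivAt (fun ξ => 𝓣.normSq (u ξ))
      (2 * 𝓣.integ (fun i x => 𝓣.val (u' τ) i x * 𝓣.val (u τ) i x)) τ := by
  have h1 : ∀ ξ, 𝓣.normSq (u ξ)
      = ∑ i, ∑ m ∈ exponents d r, ∑ l ∈ exponents d r, (u ξ i).1.coeff m * (u ξ i).1.coeff l *
        ∫ x in 𝓣.elem i, (∏ k, x k ^ m k) * ∏ k, x k ^ l k := fun ξ => by
    rw [← integ_val_mul_val, normSq]
    simp only [sq]
  simp only [h1]
  have h2 : 2 * 𝓣.integ (fun i x => 𝓣.val (u' τ) i x * 𝓣.val (u τ) i x)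
      = 𝓣.integ (fun i x => 𝓣.val (u' τ) i x * 𝓣.val (u τ) i x)
        + 𝓣.integ (fun i x => 𝓣.val (u τ) i x * 𝓣.val (u' τ) i x) := by
    simp only [mul_comm (𝓣.val (u' τ) _ _)]
    ring
  rw [h2, integ_val_mul_val, integ_val_mul_val]
  simp only [← Finset.sum_add_distrib, ← add_mul]
  exact HasDerivAt.fun_sum fun i _ => HasDerivAt.fun_sum fun m _ => HasDerivAt.fun_sum fun l _ =>
    ((h i m).mul (h i l)).mul_const _

variable {𝓣}

theorem TimeContinuousOn.continuousOn_integ {u v : ℝ → 𝓣.Vh r} {I : Set ℝ} [LocallyCompactSpace I]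
    (hu : 𝓣.TimeContinuousOn u I) (hv : 𝓣.TimeContinuousOn v I) {φ : ℝ → ℝ → ℝ}
    (hφ : Continuous fun z : ℝ × ℝ => φ z.1 z.2) :
    ContinuousOn (fun τ => 𝓣.integ fun i x => φ (𝓣.val (u τ) i x) (𝓣.val (v τ) i x)) I := by
  rw [continuousOn_iff_continuous_domRestrict]
  exact 𝓣.continuous_integ fun i =>
    hφ.comp ((𝓣.continuous_uncurry_val hu.restrict i).prodMk
      (𝓣.continuous_uncurry_val hv.restrict i))

theorem TimeContinuousOn.continuousOn_ah {u v : ℝ → 𝓣.Vh r} {I : Set ℝ} [LocallyCompactSpace I]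
    (hu : 𝓣.TimeContinuousOn u I) (hv : 𝓣.TimeContinuousOn v I) (θ σ : ℝ) :
    ContinuousOn (fun τ => 𝓣.ah θ σ (u τ) (v τ)) I := by
  rw [continuousOn_iff_continuous_domRestrict]
  exact 𝓣.continuous_ah θ σ hu.restrict hv.restrict

theorem HasTimeDerivOn.integral_eq {u u' : ℝ → 𝓣.Vh r} {T a b : ℝ}
    (hu : 𝓣.HasTimeDerivOn u u' (Icc 0 T)) (ha : 0 ≤ a) (hab : a ≤ b) (hb : b ≤ T) :
    ∫ τ in a..b, 𝓣.integ (fun i x => 𝓣.val (u' τ) i x * 𝓣.val (u τ) i x)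
      = (𝓣.normSq (u b) - 𝓣.normSq (u a)) / 2 := by
  have hsub : Icc a b ⊆ Icc 0 T := Icc_subset_Icc ha hb
  have hc := hu.timeContinuousOn.mono hsub
  have hint := (hu.2.mono hsub).continuousOn_integ hc (φ := fun x y => x * y) (by fun_prop)
  rw [eq_div_iff two_ne_zero, mul_comm, ← intervalIntegral.integral_const_mul]
  -- Derivatives in the open slab and continuity up to its ends suffice, so the one-sided
  -- derivatives at `0` and `T` do no harm.
  refine intervalIntegral.integral_eq_sub_of_hasDerivAt_of_le (f := fun τ => 𝓣.normSq (u τ)) hab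
    ?_ (fun τ hτ => ?_)
    ((hint.intervalIntegrable_of_Icc hab).const_mul 2)
  · exact hc.continuousOn_integ hc (φ := fun x _ => x ^ 2) (by fun_prop)
  · refine 𝓣.hasDerivAt_normSq fun i m => (hu.1 i m τ (hsub (Ioo_subset_Icc_self hτ))).hasDerivAt ?_
    exact Icc_mem_nhds (ha.trans_lt hτ.1) (hτ.2.trans_le hb)

theorem energy_nonneg (w₁ w₂ : 𝓣.Vh r) : 0 ≤ 𝓣.energy w₁ w₂ := by
  have h : ∀ w : 𝓣.Vh r, 0 ≤ 𝓣.normSq w := fun w => by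
    rw [normSq, integ]
    exact Finset.sum_nonneg fun i _ => integral_nonneg fun x => sq_nonneg _
  exact div_nonneg (add_nonneg (h w₁) (h w₂)) zero_le_two

/-- The reaction terms of the energy identity are bounded since `s - s² ≤ 1 / 4`. -/
theorem normSq_add_normSq_sub_le (hΩ : Bornology.IsBounded Ω) (u₁ u₂ : 𝓣.Vh r) :
    𝓣.integ (fun i x => 𝓣.val u₁ i x * 𝓣.val u₁ i x)
      + 𝓣.integ (fun i x => 𝓣.val u₂ i x * 𝓣.val u₂ i x)
      - 𝓣.integ (fun i x => (𝓣.val u₁ i x ^ 2 + 𝓣.val u₂ i x ^ 2) * 𝓣.val u₁ i x * 𝓣.val u₁ i x)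
      - 𝓣.integ (fun i x => (𝓣.val u₁ i x ^ 2 + 𝓣.val u₂ i x ^ 2) * 𝓣.val u₂ i x * 𝓣.val u₂ i x)
      ≤ volume.real Ω / 4 := by
  have hvol := 𝓣.sum_volume_elem_le hΩ
  refine le_trans ?_ (div_le_div_of_nonneg_right hvol (by norm_num))
  rw [Finset.sum_div]
  simp only [integ]
  rw [← Finset.sum_add_distrib, ← Finset.sum_sub_distrib, ← Finset.sum_sub_distrib]
  refine Finset.sum_le_sum fun i _ => ?_
  have h1 := 𝓣.continuous_val u₁ i
  have h2 := 𝓣.continuous_val u₂ i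
  have hi : ∀ {f : Pt d → ℝ}, Continuous f → Integrable f (volume.restrict (𝓣.elem i)) :=
    fun hf => 𝓣.integrableOn_elem i hf
  rw [← integral_add (hi (by fun_prop)) (hi (by fun_prop)),
    ← integral_sub (hi (by fun_prop)) (hi (by fun_prop)),
    ← integral_sub (hi (by fun_prop)) (hi (by fun_prop))]
  calc _ ≤ ∫ _ in 𝓣.elem i, (1 / 4 : ℝ) := by
        refine integral_mono (hi (by fun_prop)) (hi (by fun_prop)) fun x => ?_
        simp only
        nlinarith [sq_nonneg (𝓣.val u₁ i x ^ 2 + 𝓣.val u₂ i x ^ 2 - 1 / 2)]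
    _ = volume.real (𝓣.elem i) / 4 := by
        rw [setIntegral_const, smul_eq_mul, mul_one_div]

/-- One step of the energy estimate. -/
theorem IsSolution.energy_succ_le {θ σ α b T : ℝ} {N : ℕ} {t : ℕ → ℝ} {u₁ u₂ : ℝ → 𝓣.Vh r}
    (hu : 𝓣.IsSolution θ σ α b T N t u₁ u₂) (hΩ : Bornology.IsBounded Ω)
    (hcoer : ∀ w₁ w₂ : 𝓣.Vh r,
      0 ≤ 𝓣.ah θ σ w₁ w₁ + 𝓣.ah θ σ w₂ w₂ - α * (𝓣.ah θ σ w₂ w₁ - 𝓣.ah θ σ w₁ w₂))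
    {n : ℕ} (hn : n < N) (h0 : 0 ≤ t n) (hlt : t n ≤ t (n + 1)) (hT : t (n + 1) ≤ T) :
    𝓣.energy (u₁ (t (n + 1))) (u₂ (t (n + 1)))
      ≤ 𝓣.energy (u₁ (t n)) (u₂ (t n)) + volume.real Ω / 4 * (t (n + 1) - t n) := by
  obtain ⟨u₁', u₂', hu₁, hu₂, hsol⟩ := hu
  have hsub : Icc (t n) (t (n + 1)) ⊆ Icc 0 T := Icc_subset_Icc h0 hT
  have hc₁ := hu₁.timeContinuousOn.mono hsub
  have hc₂ := hu₂.timeContinuousOn.mono hsub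
  obtain ⟨e₁, e₂⟩ := hsol n hn u₁ u₂ hc₁ hc₂
  rw [hu₁.integral_eq h0 hlt hT] at e₁
  rw [hu₂.integral_eq h0 hlt hT] at e₂
  -- The `b` terms of the two tested equations have the same integrand and opposite signs.
  have hb : (∫ τ in t n..t (n + 1), 𝓣.integ (fun i x =>
        (𝓣.val (u₁ τ) i x ^ 2 + 𝓣.val (u₂ τ) i x ^ 2) * 𝓣.val (u₂ τ) i x * 𝓣.val (u₁ τ) i x))
      = ∫ τ in t n..t (n + 1), 𝓣.integ (fun i x =>
        (𝓣.val (u₁ τ) i x ^ 2 + 𝓣.val (u₂ τ) i x ^ 2) * 𝓣.val (u₁ τ) i x * 𝓣.val (u₂ τ) i x) := by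
    simp only [mul_right_comm _ (𝓣.val (u₂ _) _ _) (𝓣.val (u₁ _) _ _)]
  rw [hb] at e₁
  have hA₁ : ContinuousOn (fun τ => -𝓣.ah θ σ (u₁ τ) (u₁ τ) + α * 𝓣.ah θ σ (u₂ τ) (u₁ τ))
      (Icc (t n) (t (n + 1))) :=
    (hc₁.continuousOn_ah hc₁ θ σ).neg.add (continuousOn_const.mul (hc₂.continuousOn_ah hc₁ θ σ))
  have hA₂ : ContinuousOn (fun τ => -(α * 𝓣.ah θ σ (u₁ τ) (u₂ τ)) - 𝓣.ah θ σ (u₂ τ) (u₂ τ))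
      (Icc (t n) (t (n + 1))) :=
    (continuousOn_const.mul (hc₁.continuousOn_ah hc₂ θ σ)).neg.sub (hc₂.continuousOn_ah hc₂ θ σ)
  have hL₁ := hc₁.continuousOn_integ hc₁ (φ := fun x y => x * y) (by fun_prop)
  have hL₂ := hc₂.continuousOn_integ hc₂ (φ := fun x y => x * y) (by fun_prop)
  have hR₁ := hc₁.continuousOn_integ hc₂ (φ := fun x y => (x ^ 2 + y ^ 2) * x * x) (by fun_prop)
  have hR₂ := hc₁.continuousOn_integ hc₂ (φ := fun x y => (x ^ 2 + y ^ 2) * y * y) (by fun_prop)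
  have hA := hA₁.fun_add hA₂
  have hR := ((hL₁.fun_add hL₂).fun_sub hR₁).fun_sub hR₂
  -- At each time the diffusion part is nonpositive by coercivity and the reaction part is at most
  -- `|Ω| / 4`.
  have key := intervalIntegral.integral_mono_on hlt
    ((hA.fun_add hR).intervalIntegrable_of_Icc hlt) (intervalIntegrable_const (μ := volume))
    (g := fun _ => volume.real Ω / 4) fun τ _ => by
      have h1 := hcoer (u₁ τ) (u₂ τ)
      have h2 := normSq_add_normSq_sub_le hΩ (u₁ τ) (u₂ τ)
      linarith
  have hii : ∀ {f : ℝ → ℝ}, ContinuousOn f (Icc (t n) (t (n + 1))) →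
      IntervalIntegrable f volume (t n) (t (n + 1)) := fun hf => hf.intervalIntegrable_of_Icc hlt
  rw [intervalIntegral.integral_add (hii hA) (hii hR),
    intervalIntegral.integral_add (hii hA₁) (hii hA₂),
    intervalIntegral.integral_sub (hii ((hL₁.fun_add hL₂).fun_sub hR₁)) (hii hR₂),
    intervalIntegral.integral_sub (hii (hL₁.fun_add hL₂)) (hii hR₁),
    intervalIntegral.integral_add (hii hL₁) (hii hL₂),
    intervalIntegral.integral_const, smul_eq_mul] at key
  simp only [energy]
  linarith

end Mesh

end GLDG

/-! ### Summation over the time steps. -/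

theorem theorem3p2 (d : ℕ) (hd : 2 ≤ d) (r : ℕ) (κ α : ℝ) :
    ∃ σ₀ : ℝ, 0 < σ₀ ∧ ∀ σ : ℝ, σ₀ ≤ σ →
    ∀ θ : ℝ, θ = 1 ∨ θ = -1 ∨ θ = 0 →
    ∀ (b M : ℝ) (Ω : Set (GLDG.Pt d)), IsOpen Ω → Bornology.IsBounded Ω →
    ∃ c : ℝ, 0 ≤ c ∧
    ∀ 𝓣 : GLDG.Mesh Ω, 𝓣.ShapeRegular κ →
    ∀ (T Δt : ℝ) (N : ℕ) (t : ℕ → ℝ), t 0 = 0 → t N = T →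
    (∀ n < N, t n < t (n + 1)) → (∀ n < N, t (n + 1) - t n ≤ Δt) →
    ∀ u₁ u₂ : ℝ → 𝓣.Vh r,
    𝓣.IsSolution θ σ α b T N t u₁ u₂ →
    𝓣.BoundedBy u₁ M (Set.Icc 0 T) → 𝓣.BoundedBy u₂ M (Set.Icc 0 T) →
    ∀ C : ℝ, 1 ≤ C →
      (∀ n < N, 𝓣.energy (u₁ (t (n + 1))) (u₂ (t (n + 1)))
        ≤ C * 𝓣.energy (u₁ (t n)) (u₂ (t n)) + c * (t (n + 1) - t n)) ∧
      (C ≠ 1 → 𝓣.energy (u₁ (t N)) (u₂ (t N))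
        ≤ 𝓣.energy (u₁ (t 0)) (u₂ (t 0)) * C ^ N + c * Δt * ((C ^ N - 1) / (C - 1))) ∧
      (C = 1 → 𝓣.energy (u₁ (t N)) (u₂ (t N))
        ≤ 𝓣.energy (u₁ (t 0)) (u₂ (t 0)) + c * N * Δt) := by
  obtain ⟨σ₀, hσ₀, hcoer⟩ := GLDG.Mesh.exists_forall_ah_nonneg hd r κ α
  refine ⟨σ₀, hσ₀, fun σ hσ θ hθ b M Ω _ hΩ => ⟨volume.real Ω / 4, by positivity, ?_⟩⟩
  intro 𝓣 h𝓣 T Δt N t ht0 htN hlt hΔ u₁ u₂ hu _ _ C hC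
  have hθ' : |θ| ≤ 1 := by rcases hθ with rfl | rfl | rfl <;> norm_num
  have hmono : MonotoneOn t (Set.Iic N) :=
    monotoneOn_of_le_succ Set.ordConnected_Iic fun n _ _ hn => (hlt n hn).le
  have hstep : ∀ n < N, 𝓣.energy (u₁ (t (n + 1))) (u₂ (t (n + 1)))
      ≤ C * 𝓣.energy (u₁ (t n)) (u₂ (t n)) + volume.real Ω / 4 * (t (n + 1) - t n) := by
    intro n hn
    have h0 : 0 ≤ t n := ht0 ▸ hmono (Nat.zero_le N) hn.le (Nat.zero_le n)
    have hT : t (n + 1) ≤ T := htN ▸ hmono (Nat.succ_le_of_lt hn) (le_refl N) hn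
    have h1 := hu.energy_succ_le hΩ (hcoer σ hσ θ hθ' 𝓣 h𝓣) hn h0 (hlt n hn).le hT
    -- The estimate is already available with factor one; nonnegativity of the energy allows any `C
    -- ≥ 1`.
    have h2 := le_mul_of_one_le_left (GLDG.Mesh.energy_nonneg (u₁ (t n)) (u₂ (t n))) hC
    linarith
  have hgron := le_mul_pow_add_of_forall_le_mul_add (N := N)
    (a := fun n => 𝓣.energy (u₁ (t n)) (u₂ (t n))) (D := volume.real Ω / 4 * Δt)
    (zero_le_one.trans hC) fun n hn => (hstep n hn).trans (by gcongr; exact hΔ n hn)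
  refine ⟨hstep, fun hC1 => ?_, fun hC1 => ?_⟩
  · rwa [geom_sum_eq hC1] at hgron
  · subst hC1
    simp only [one_pow, mul_one, Finset.sum_const, Finset.card_range, nsmul_eq_mul] at hgron
    rwa [mul_right_comm]
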